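/- Consider $m$ indivisible chores $O=\{o_1,\dots,o_m\}$ and two agents $1,2$. Agent $i$ has a cost function $c_i:2^O\to\mathbb{R}_{\ge 0}$ that is additive, $c_i(S)=\sum_{o\in S}c_i(\{o\})$, and normalized, $c_i(O)=1$. An allocation is an ordered partition $A=(A_1,A_2)$ of $O$ into two (possibly empty) bundles; its social cost is $c_1(A_1)+c_2(A_2)$. It is envy-free up to one item (EF1) if for all agents $i,j$ with $A_i\neq\emptyset$ there is an item $o\in A_i$ with $c_i(A_i\setminus\{o\})\le c_i(A_j)$. Let $\mathsf{OPT}^{EF1}$ denote the minimum social cost of an EF1 allocation of the instance. There is an algorithm (a single program of a real RAM, that is, of a random access machine with exact arithmetic and comparison of real numbers at unit cost and without rounding operations) which, given the $2m$ costs $c_i(\{o\})$ of any such instance and any accuracy parameter $\varepsilon>0$, computes an EF1 allocation with social cost at most $\mathsf{OPT}^{EF1}+\varepsilon$, in a number of steps bounded by a polynomial in $m$ and $1/\varepsilon$. The polynomial does not depend on the instance or on $\varepsilon$. -/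

import Mathlib

/-! ### Chore division -/

/-- An instance of the allocation of `m` indivisible chores to `n` agents, with nonnegative,
additive and normalized cost functions. An additive cost function is given by the costs of the
single items. -/
structure ChoreInstance (n m : ℕ) where
  /-- `cost i o` is the cost of the item `o` for the agent `i`. -/
  cost : Fin n → Fin m → ℝ
  cost_nonneg : ∀ i o, 0 ≤ cost i o
  cost_total : ∀ i, ∑ o, cost i o = 1

/-- An allocation: an ordered partition of the items into `n` (possibly empty) bundles, given by
the agent that receives each item. -/
abbrev Allocation (n m : ℕ) : Type := Fin m → Fin n

/-- The bundle of agent `i`. -/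
def Allocation.bundle {n m : ℕ} (A : Allocation n m) (i : Fin n) : Finset (Fin m) :=
  Finset.univ.filter fun o => A o = i

namespace ChoreInstance

variable {n m : ℕ}

/-- The cost of a set of items for agent `i`. -/
def costOf (I : ChoreInstance n m) (i : Fin n) (S : Finset (Fin m)) : ℝ :=
  ∑ o ∈ S, I.cost i o

/-- The social cost of an allocation. -/
def socialCost (I : ChoreInstance n m) (A : Allocation n m) : ℝ :=
  ∑ i, I.costOf i (A.bundle i)

/-- Envy-freeness up to one item (for chores). An agent with an empty bundle has nothing to
remove and envies nobody. -/
def IsEF1 (I : ChoreInstance n m) (A : Allocation n m) : Prop :=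
  ∀ i j : Fin n, A.bundle i = ∅ ∨
    ∃ o ∈ A.bundle i, I.costOf i ((A.bundle i).erase o) ≤ I.costOf i (A.bundle j)

/-- The social costs of the EF1 allocations. -/
def ef1Costs (I : ChoreInstance n m) : Set ℝ :=
  {x | ∃ A : Allocation n m, I.IsEF1 A ∧ I.socialCost A = x}

/-- The minimum social cost of an EF1 allocation. -/
noncomputable def optEF1 (I : ChoreInstance n m) : ℝ := sInf I.ef1Costs

/-- As soon as there is an EF1 allocation, the infimum in `optEF1` is a minimum. -/
theorem isLeast_optEF1 (I : ChoreInstance n m) (h : I.ef1Costs.Nonempty) :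
    IsLeast I.ef1Costs I.optEF1 := by
  have hfin : I.ef1Costs.Finite := by
    refine (Set.finite_range I.socialCost).subset ?_
    rintro x ⟨A, -, rfl⟩
    exact ⟨A, rfl⟩
  exact ⟨h.csInf_mem hfin, fun x hx => csInf_le hfin.bddBelow hx⟩

end ChoreInstance

/-! ### The real RAM

A random access machine with natural number cells (for counting, for addressing and for the
output) and real number cells. Its programs are structured (assignments, sequences,
conditionals, loops). It has the exact arithmetic operations and comparisons of real numbers at
unit cost, no rounding, no conversion of a real number into an integer, and no multiplication of
integers. -/

namespace RealRAM

/-- The memory: cell `i` of the natural number array `a` is `nat a i`, and cell `i` of the real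
number array `a` is `real a i`. A program addresses finitely many arrays, each at computed
indices. -/
structure State where
  nat : ℕ → ℕ → ℕ
  real : ℕ → ℕ → ℝ

/-- Expressions with natural number values; `sub` is truncated subtraction and `get a e` reads
the cell `e` of the natural number array `a`. -/
inductive NExpr where
  | const (k : ℕ)
  | get (a : ℕ) (e : NExpr)
  | add (e f : NExpr)
  | sub (e f : NExpr)

/-- Expressions with real values; `get a e` reads the cell `e` of the real array `a`. -/
inductive RExpr where
  | ofNat (e : NExpr)
  | get (a : ℕ) (e : NExpr)
  | add (e f : RExpr)
  | sub (e f : RExpr)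
  | mul (e f : RExpr)
  | div (e f : RExpr)

/-- Tests. -/
inductive Test where
  | natLe (e f : NExpr)
  | realLe (e f : RExpr)
  | not (b : Test)
  | and (b c : Test)

/-- Programs. `setNat a e f` stores the value of `f` in the cell `e` of the natural number array
`a`, and `setReal a e f` does the same with real numbers. -/
inductive Program where
  | skip
  | setNat (a : ℕ) (e f : NExpr)
  | setReal (a : ℕ) (e : NExpr) (f : RExpr)
  | seq (P Q : Program)
  | ite (b : Test) (P Q : Program)
  | loop (b : Test) (P : Program)

/-- The value of an expression. -/
def NExpr.eval (s : State) : NExpr → ℕ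
  | .const k => k
  | .get a e => s.nat a (e.eval s)
  | .add e f => e.eval s + f.eval s
  | .sub e f => e.eval s - f.eval s

/-- The number of steps it takes to evaluate an expression: one for each operation, memory
access and constant in it. -/
def NExpr.steps : NExpr → ℕ
  | .const _ => 1
  | .get _ e => e.steps + 1
  | .add e f => e.steps + f.steps + 1
  | .sub e f => e.steps + f.steps + 1

/-- The value of an expression. A division by zero returns zero; as a program can test a divisor,
this gives it no additional power. -/
noncomputable def RExpr.eval (s : State) : RExpr → ℝ
  | .ofNat e => (e.eval s : ℝ)
  | .get a e => s.real a (e.eval s)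
  | .add e f => e.eval s + f.eval s
  | .sub e f => e.eval s - f.eval s
  | .mul e f => e.eval s * f.eval s
  | .div e f => e.eval s / f.eval s

/-- The number of steps it takes to evaluate an expression. -/
def RExpr.steps : RExpr → ℕ
  | .ofNat e => e.steps + 1
  | .get _ e => e.steps + 1
  | .add e f => e.steps + f.steps + 1
  | .sub e f => e.steps + f.steps + 1
  | .mul e f => e.steps + f.steps + 1
  | .div e f => e.steps + f.steps + 1

/-- The outcome of a test. -/
def Test.Holds (s : State) : Test → Prop
  | .natLe e f => e.eval s ≤ f.eval s
  | .realLe e f => e.eval s ≤ f.eval s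
  | .not b => ¬ b.Holds s
  | .and b c => b.Holds s ∧ c.Holds s

/-- The number of steps it takes to evaluate a test. -/
def Test.steps : Test → ℕ
  | .natLe e f => e.steps + f.steps + 1
  | .realLe e f => e.steps + f.steps + 1
  | .not b => b.steps + 1
  | .and b c => b.steps + c.steps + 1

/-- Store a natural number. -/
def State.putNat (s : State) (a i v : ℕ) : State :=
  { s with nat := Function.update s.nat a (Function.update (s.nat a) i v) }

/-- Store a real number. -/
noncomputable def State.putReal (s : State) (a i : ℕ) (v : ℝ) : State :=
  { s with real := Function.update s.real a (Function.update (s.real a) i v) }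

/-- `Runs P s t s'`: started in the state `s`, the program `P` terminates in the state `s'` after
exactly `t` steps. -/
inductive Runs : Program → State → ℕ → State → Prop
  | skip (s : State) : Runs .skip s 1 s
  | setNat (a : ℕ) (e f : NExpr) (s : State) :
      Runs (.setNat a e f) s (e.steps + f.steps + 1) (s.putNat a (e.eval s) (f.eval s))
  | setReal (a : ℕ) (e : NExpr) (f : RExpr) (s : State) :
      Runs (.setReal a e f) s (e.steps + f.steps + 1) (s.putReal a (e.eval s) (f.eval s))
  | seq {P Q : Program} {s s₁ s₂ : State} {t₁ t₂ : ℕ} :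
      Runs P s t₁ s₁ → Runs Q s₁ t₂ s₂ → Runs (.seq P Q) s (t₁ + t₂) s₂
  | iteTrue {b : Test} {P Q : Program} {s s₁ : State} {t : ℕ} :
      b.Holds s → Runs P s t s₁ → Runs (.ite b P Q) s (b.steps + 1 + t) s₁
  | iteFalse {b : Test} {P Q : Program} {s s₁ : State} {t : ℕ} :
      ¬ b.Holds s → Runs Q s t s₁ → Runs (.ite b P Q) s (b.steps + 1 + t) s₁
  | loopDone {b : Test} {P : Program} {s : State} :
      ¬ b.Holds s → Runs (.loop b P) s (b.steps + 1) s
  | loopStep {b : Test} {P : Program} {s s₁ s₂ : State} {t₁ t₂ : ℕ} :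
      b.Holds s → Runs P s t₁ s₁ → Runs (.loop b P) s₁ t₂ s₂ →
        Runs (.loop b P) s (b.steps + 1 + t₁ + t₂) s₂

/-- The machine is deterministic: the number of steps and the final state of a terminating
computation are determined by the program and the initial state. -/
theorem Runs.deterministic {P : Program} {s s₁ s₂ : State} {t₁ t₂ : ℕ}
    (h₁ : Runs P s t₁ s₁) (h₂ : Runs P s t₂ s₂) : t₁ = t₂ ∧ s₁ = s₂ := by
  induction h₁ generalizing t₂ s₂ with
  | skip s => cases h₂; exact ⟨rfl, rfl⟩
  | setNat a e f s => cases h₂; exact ⟨rfl, rfl⟩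
  | setReal a e f s => cases h₂; exact ⟨rfl, rfl⟩
  | seq _ _ ih₁ ih₂ =>
    cases h₂ with
    | seq k₁ k₂ =>
      obtain ⟨rfl, rfl⟩ := ih₁ k₁
      obtain ⟨rfl, rfl⟩ := ih₂ k₂
      exact ⟨rfl, rfl⟩
  | iteTrue hb _ ih =>
    cases h₂ with
    | iteTrue _ k => obtain ⟨rfl, rfl⟩ := ih k; exact ⟨rfl, rfl⟩
    | iteFalse hb' _ => exact absurd hb hb'
  | iteFalse hb _ ih =>
    cases h₂ with
    | iteTrue hb' _ => exact absurd hb' hb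
    | iteFalse _ k => obtain ⟨rfl, rfl⟩ := ih k; exact ⟨rfl, rfl⟩
  | loopDone hb =>
    cases h₂ with
    | loopDone _ => exact ⟨rfl, rfl⟩
    | loopStep hb' _ _ => exact absurd hb' hb
  | loopStep hb _ _ ih₁ ih₂ =>
    cases h₂ with
    | loopDone hb' => exact absurd hb hb'
    | loopStep _ k₁ k₂ =>
      obtain ⟨rfl, rfl⟩ := ih₁ k₁
      obtain ⟨rfl, rfl⟩ := ih₂ k₂
      exact ⟨rfl, rfl⟩

/-- The initial state for a two-agent instance and an accuracy `ε`: the number `m` of items is in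
cell `0` of the natural number array `0`, the accuracy is in cell `0` of the real array `0`, the
costs of the items for the first and for the second agent are in the cells `0, …, m - 1` of the
real arrays `1` and `2`, and all other cells contain `0`. -/
noncomputable def input {m : ℕ} (I : ChoreInstance 2 m) (ε : ℝ) : State where
  nat a i := if a = 0 ∧ i = 0 then m else 0
  real a i :=
    if a = 0 ∧ i = 0 then ε
    else if h : i < m then
      if a = 1 then I.cost 0 ⟨i, h⟩ else if a = 2 then I.cost 1 ⟨i, h⟩ else 0
    else 0

/-- The final state `s` holds the allocation `A`: the cells `0, …, m - 1` of the natural number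
array `1` contain the agents (`0` or `1`) that receive the items. -/
def Outputs {m : ℕ} (s : State) (A : Allocation 2 m) : Prop :=
  ∀ o : Fin m, s.nat 1 o = (A o : ℕ)

end RealRAM

namespace RealRAM

/-! ### Reasoning about programs -/

/-! Call the agents `p` and `q`, and flag the items that are to be allowed to `p`; each flagged item
is at most as costly for `p` as for `q`, and each unflagged item is at most as costly for `q` as for
`p`. By normalization the order of the agents can be chosen so that the unflagged items together
cost `q` at most `1 / 2` (`agentProgram_spec`).

Relaxation: in any EF1 allocation, hand the unflagged items of `p` to `q`. The social cost does not
rise and `p` stays EF1, while the condition on `q` is dropped. It remains to choose a set of flagged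
items that `p` keeps, of least social cost, subject to EF1 for `p` alone. Since `p` values
everything at `1`, that condition reads `2 c(S) - c(g) ≤ 1` for some item `g`. For a fixed guess of
`g` it is one linear constraint, so the task is a knapsack problem. The objective is the total loss
`c_q - c_p` over the flagged items given up. Losses are rounded down to multiples of `ε / m`, which
costs at most `ε` in total (`cost_le_of_rounded_le`). The total loss is at most `1`, so about `m /
ε` budgets suffice and dynamic programming is polynomial.

Repair: if the social cost found exceeds `1`, everything goes to `q`, at cost `1`. Then, while `q`
would still envy `p` after removal of a given flagged item, that item returns to `p`. The social
cost does not rise, and the bound `1` on it keeps `p` EF1 (`keptEF1_update`). In the end either `q`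
holds a flagged item whose removal suffices, or `q` holds only unflagged items, worth at most `1 /
2` (`isEF1_allocationOf`). So the output is EF1 and within `ε` of the relaxed optimum, hence of the
EF1 optimum. In particular an EF1 allocation exists. -/

@[simp] theorem State.putNat_nat (s : State) (a i v b j : ℕ) :
    (s.putNat a i v).nat b j = if b = a ∧ j = i then v else s.nat b j := by
  by_cases h : b = a
  · subst h
    by_cases h' : j = i <;> simp [State.putNat, h']
  · simp [State.putNat, h]

@[simp] theorem State.putNat_real (s : State) (a i v : ℕ) : (s.putNat a i v).real = s.real := rfl

@[simp] theorem State.putReal_real (s : State) (a i b j : ℕ) (v : ℝ) :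
    (s.putReal a i v).real b j = if b = a ∧ j = i then v else s.real b j := by
  by_cases h : b = a
  · subst h
    by_cases h' : j = i <;> simp [State.putReal, h']
  · simp [State.putReal, h]

@[simp] theorem State.putReal_nat (s : State) (a i : ℕ) (v : ℝ) :
    (s.putReal a i v).nat = s.nat := rfl

/-! ### Frame rule: arrays without assignments are unchanged -/

/-- Whether a program contains an assignment to the natural number array `a`. -/
def Program.writesNat (a : ℕ) : Program → Bool
  | .skip => false
  | .setNat b _ _ => a == b
  | .setReal _ _ _ => false
  | .seq P Q => P.writesNat a || Q.writesNat a
  | .ite _ P Q => P.writesNat a || Q.writesNat a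
  | .loop _ P => P.writesNat a

/-- Whether a program contains an assignment to the real array `a`. -/
def Program.writesReal (a : ℕ) : Program → Bool
  | .skip => false
  | .setNat _ _ _ => false
  | .setReal b _ _ => a == b
  | .seq P Q => P.writesReal a || Q.writesReal a
  | .ite _ P Q => P.writesReal a || Q.writesReal a
  | .loop _ P => P.writesReal a

/-- The states `s` and `s'` agree on the arrays to which `P` does not write. -/
def Frame (P : Program) (s s' : State) : Prop :=
  (∀ a, P.writesNat a = false → s'.nat a = s.nat a) ∧
    ∀ a, P.writesReal a = false → s'.real a = s.real a

theorem Frame.refl (P : Program) (s : State) : Frame P s s := ⟨fun _ _ => rfl, fun _ _ => rfl⟩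

theorem Frame.trans {P : Program} {s s₁ s₂ : State} (h : Frame P s s₁) (h' : Frame P s₁ s₂) :
    Frame P s s₂ :=
  ⟨fun a ha => (h'.1 a ha).trans (h.1 a ha), fun a ha => (h'.2 a ha).trans (h.2 a ha)⟩

theorem Frame.mono {P Q : Program} {s s' : State} (h : Frame P s s')
    (hn : ∀ a, Q.writesNat a = false → P.writesNat a = false)
    (hr : ∀ a, Q.writesReal a = false → P.writesReal a = false) : Frame Q s s' :=
  ⟨fun a ha => h.1 a (hn a ha), fun a ha => h.2 a (hr a ha)⟩

/-- A program changes only the arrays to which it writes. -/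
theorem Runs.frame {P : Program} {s s' : State} {t : ℕ} (h : Runs P s t s') : Frame P s s' := by
  induction h with
  | skip s => exact Frame.refl _ _
  | setNat a e f s =>
    refine ⟨fun b hb => ?_, fun _ _ => rfl⟩
    have : b ≠ a := by simpa [Program.writesNat] using hb
    ext j
    simp [this]
  | setReal a e f s =>
    refine ⟨fun _ _ => rfl, fun b hb => ?_⟩
    have : b ≠ a := by simpa [Program.writesReal] using hb
    ext j
    simp [this]
  | seq _ _ ih₁ ih₂ =>
    refine (ih₁.mono ?_ ?_).trans (ih₂.mono ?_ ?_) <;>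
      simp +contextual [Program.writesNat, Program.writesReal]
  | iteTrue _ _ ih =>
    refine ih.mono ?_ ?_ <;> simp +contextual [Program.writesNat, Program.writesReal]
  | iteFalse _ _ ih =>
    refine ih.mono ?_ ?_ <;> simp +contextual [Program.writesNat, Program.writesReal]
  | loopDone _ => exact Frame.refl _ _
  | loopStep _ _ _ ih₁ ih₂ =>
    refine (ih₁.mono ?_ ?_).trans ih₂ <;>
      simp [Program.writesNat, Program.writesReal]

/-! ### Total correctness with step bounds -/

/-- Started in the state `s`, the program `P` terminates after at most `n` steps, in a state
with the property `post`. -/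
def Ends (P : Program) (s : State) (n : ℕ) (post : State → Prop) : Prop :=
  ∃ t s', Runs P s t s' ∧ t ≤ n ∧ post s'

/-- The consequence rule. The frame is handed to the caller, so that postconditions need not mention
the arrays that stay fixed; since `writesNat` and `writesReal` compute, such facts are later proved
by `rfl`. -/
theorem Ends.imp {P : Program} {s : State} {n n' : ℕ} {p q : State → Prop} (h : Ends P s n p)
    (hn : n ≤ n') (hpq : ∀ s', Frame P s s' → p s' → q s') : Ends P s n' q := by
  obtain ⟨t, s', hr, ht, hp⟩ := h
  exact ⟨t, s', hr, ht.trans hn, hpq s' hr.frame hp⟩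

theorem Ends.seq {P Q : Program} {s : State} {n₁ n₂ : ℕ} {p q : State → Prop}
    (h : Ends P s n₁ p) (h' : ∀ s', Frame P s s' → p s' → Ends Q s' n₂ q) :
    Ends (.seq P Q) s (n₁ + n₂) q := by
  obtain ⟨t, s', hr, ht, hp⟩ := h
  obtain ⟨t', s'', hr', ht', hq⟩ := h' s' hr.frame hp
  exact ⟨t + t', s'', hr.seq hr', by omega, hq⟩

/-- Both branches are charged, so the bound does not depend on the outcome of the test. -/
theorem Ends.ite {b : Test} {P Q : Program} {s : State} {n₁ n₂ : ℕ} {p : State → Prop}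
    (h : b.Holds s → Ends P s n₁ p) (h' : ¬ b.Holds s → Ends Q s n₂ p) :
    Ends (.ite b P Q) s (b.steps + 1 + (n₁ + n₂)) p := by
  by_cases hb : b.Holds s
  · obtain ⟨t, s', hr, ht, hp⟩ := h hb
    exact ⟨_, s', .iteTrue hb hr, by omega, hp⟩
  · obtain ⟨t, s', hr, ht, hp⟩ := h' hb
    exact ⟨_, s', .iteFalse hb hr, by omega, hp⟩

/-- A program without loops. -/
def Program.LoopFree : Program → Prop
  | .skip => True
  | .setNat _ _ _ => True
  | .setReal _ _ _ => True
  | .seq P Q => P.LoopFree ∧ Q.LoopFree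
  | .ite _ P Q => P.LoopFree ∧ Q.LoopFree
  | .loop _ _ => False

open Classical in
/-- The final state of a program without loops. -/
noncomputable def Program.exec : Program → State → State
  | .skip, s => s
  | .setNat a e f, s => s.putNat a (e.eval s) (f.eval s)
  | .setReal a e f, s => s.putReal a (e.eval s) (f.eval s)
  | .seq P Q, s => Q.exec (P.exec s)
  | .ite b P Q, s => if b.Holds s then P.exec s else Q.exec s
  | .loop _ _, s => s

/-- A bound on the running time of a program without loops. -/
def Program.size : Program → ℕ
  | .skip => 1
  | .setNat _ e f => e.steps + f.steps + 1
  | .setReal _ e f => e.steps + f.steps + 1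
  | .seq P Q => P.size + Q.size
  | .ite b P Q => b.steps + 1 + (P.size + Q.size)
  | .loop _ _ => 0

theorem Program.LoopFree.ends {P : Program} (h : P.LoopFree) (s : State) :
    Ends P s P.size (· = P.exec s) := by
  induction P generalizing s with
  | skip => exact ⟨_, _, .skip s, le_rfl, rfl⟩
  | setNat a e f => exact ⟨_, _, .setNat a e f s, le_rfl, rfl⟩
  | setReal a e f => exact ⟨_, _, .setReal a e f s, le_rfl, rfl⟩
  | seq P Q ihP ihQ =>
    refine (ihP h.1 s).seq fun s' _ hs' => ?_
    subst hs'
    exact ihQ h.2 _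
  | ite b P Q ihP ihQ =>
    refine Ends.ite (fun hb => ?_) fun hb => ?_
    · simpa [Program.exec, hb] using ihP h.1 s
    · simpa [Program.exec, hb] using ihQ h.2 s
  | loop b P => exact h.elim

theorem Ends.of_exec {P : Program} (h : P.LoopFree) {s : State} {n : ℕ} {p : State → Prop}
    (hn : P.size ≤ n) (hp : p (P.exec s)) : Ends P s n p :=
  (h.ends s).imp hn fun _ _ hs => hs ▸ hp

/-- A loop whose `i`-th iteration leads from the invariant `Inv i` to `Inv (i + 1)` and which
stops after `n` iterations. -/
theorem Ends.loop {b : Test} {P : Program} {n k : ℕ} (Inv : ℕ → State → Prop) {s : State}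
    (h0 : Inv 0 s) (hstep : ∀ i s', i < n → Frame P s s' → Inv i s' →
      b.Holds s' ∧ Ends P s' k (Inv (i + 1)))
    (hend : ∀ s', Frame P s s' → Inv n s' → ¬ b.Holds s') :
    Ends (.loop b P) s (n * (b.steps + 1 + k) + (b.steps + 1)) (Inv n) := by
  -- Induction on the number `j` of iterations that remain, since `Runs` unfolds a loop from its
  -- first iteration.
  have key : ∀ j i s', i + j = n → Frame P s s' → Inv i s' →
      Ends (.loop b P) s' (j * (b.steps + 1 + k) + (b.steps + 1)) (Inv n) := by
    intro j
    induction j with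
    | zero =>
      intro i s' hi hf hs'
      obtain rfl : i = n := by omega
      exact ⟨_, s', .loopDone (hend s' hf hs'), by omega, hs'⟩
    | succ j ih =>
      intro i s' hi hf hs'
      obtain ⟨hb, t, s₁, hr, ht, h₁⟩ := hstep i s' (by omega) hf hs'
      obtain ⟨t', s₂, hr', ht', h₂⟩ := ih (i + 1) s₁ (by omega) (hf.trans hr.frame) h₁
      refine ⟨_, s₂, .loopStep hb hr hr', ?_, h₂⟩
      rw [Nat.add_mul]
      omega
  exact key n 0 s (by omega) (Frame.refl _ _) h0

/-- The value of the cell `0` of the natural number array `a`. -/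
def NExpr.var (a : ℕ) : NExpr := .get a (.const 0)

@[simp] theorem NExpr.eval_var (a : ℕ) (s : State) : (NExpr.var a).eval s = s.nat a 0 := rfl

/-- Run `P` with the values `0, …, n - 1` in the cell `0` of the natural number array `c`, where
`n` is the value of the cell `0` of the natural number array `b`. -/
def Program.for (c b : ℕ) (P : Program) : Program :=
  .seq (.setNat c (.const 0) (.const 0))
    (.loop (.not (.natLe (.var b) (.var c)))
      (.seq P (.setNat c (.const 0) (.add (.var c) (.const 1)))))

/-- The invariant must be insensitive to the counter cell (`hInv`), because the counter is written
between iterations. The body must leave both the counter and the bound alone. -/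
theorem Ends.for {c b : ℕ} {P : Program} {s : State} {n k : ℕ} (Inv : ℕ → State → Prop)
    (hcb : b ≠ c) (hb : P.writesNat b = false) (hc : P.writesNat c = false)
    (hn : s.nat b 0 = n)
    (hInv : ∀ i s' v, Inv i s' → Inv i (s'.putNat c 0 v))
    (h0 : Inv 0 s)
    (hstep : ∀ i s', i < n → s'.nat c 0 = i → Frame (.for c b P) s s' → Inv i s' →
      Ends P s' k (Inv (i + 1))) :
    Ends (.for c b P) s ((n + 1) * (k + 14)) (Inv n) := by
  have hset : Ends (.setNat c (.const 0) (.const 0)) s 3 (· = s.putNat c 0 0) :=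
    ⟨_, _, .setNat _ _ _ _, le_rfl, rfl⟩
  -- The test with its branching costs 7 steps, the increment 6 and the initialization 3; the
  -- overhead 14 per round in the conclusion absorbs all of them.
  refine (hset.seq (n₂ := n * (7 + (k + 6)) + 7) (q := Inv n) ?_).imp ?_ fun _ _ h => h
  · intro s₀ hf₀ hs₀
    have hwb : (Program.seq P (.setNat c (.const 0) (.add (.var c) (.const 1)))).writesNat b
        = false := by simp [Program.writesNat, hb, hcb]
    have hb₀ : s₀.nat b 0 = n := by rw [hs₀]; simp [hcb, hn]
    refine (Ends.loop (fun i s' => s'.nat c 0 = i ∧ Inv i s') (n := n) (k := k + 6) ?_ ?_ ?_).imp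
      le_rfl fun _ _ h => h.2
    · rw [hs₀]
      exact ⟨by simp, hInv _ _ _ h0⟩
    · rintro i s' hi hf ⟨hc', hI⟩
      have hbs : s'.nat b 0 = n := by rw [hf.1 b hwb, hb₀]
      refine ⟨by simp [Test.Holds, hbs, hc', hi], ?_⟩
      have hfr : Frame (.for c b P) s s' := by
        refine Frame.trans (s₁ := s₀) (hf₀.mono ?_ ?_) (hf.mono ?_ ?_) <;>
          simp +contextual [Program.for, Program.writesNat, Program.writesReal]
      refine (hstep i s' hi hc' hfr hI).seq fun s₁ hf₁ hI₁ => ?_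
      refine ⟨_, _, .setNat _ _ _ _, le_rfl, ?_, hInv _ _ _ hI₁⟩
      have : s₁.nat c 0 = i := by rw [hf₁.1 c hc, hc']
      simp [NExpr.eval, this]
    · rintro s' hf ⟨hc', -⟩
      have hbs : s'.nat b 0 = n := by rw [hf.1 b hwb, hb₀]
      simp [Test.Holds, hbs, hc']
  · ring_nf
    omega

end RealRAM

/-! ### Subsets given by bit vectors -/

section BitVectors

variable {M : Type*} [AddCommMonoid M]

/-- The sum of `w` over the indices below `n` at which `K` has the value `1`. -/
def keptSum (n : ℕ) (K : ℕ → ℕ) (w : ℕ → M) : M :=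
  ∑ o ∈ Finset.range n, if K o = 1 then w o else 0

/-- The sum of `w` over the indices below `n` at which `K` does not have the value `1`. -/
def movedSum (n : ℕ) (K : ℕ → ℕ) (w : ℕ → M) : M :=
  ∑ o ∈ Finset.range n, if K o = 1 then 0 else w o

theorem keptSum_succ (n : ℕ) (K : ℕ → ℕ) (w : ℕ → M) :
    keptSum (n + 1) K w = keptSum n K w + if K n = 1 then w n else 0 :=
  Finset.sum_range_succ _ _

theorem movedSum_succ (n : ℕ) (K : ℕ → ℕ) (w : ℕ → M) :
    movedSum (n + 1) K w = movedSum n K w + if K n = 1 then 0 else w n :=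
  Finset.sum_range_succ _ _

theorem keptSum_add_movedSum (n : ℕ) (K : ℕ → ℕ) (w : ℕ → M) :
    keptSum n K w + movedSum n K w = ∑ o ∈ Finset.range n, w o := by
  rw [keptSum, movedSum, ← Finset.sum_add_distrib]
  exact Finset.sum_congr rfl fun o _ => by split_ifs <;> simp

theorem keptSum_update {n k : ℕ} (hk : k < n) {K : ℕ → ℕ} (hK : K k ≠ 1) (w : ℕ → M) :
    keptSum n (Function.update K k 1) w = keptSum n K w + w k := by
  have hk' : k ∈ Finset.range n := Finset.mem_range.2 hk
  rw [keptSum, keptSum, ← Finset.add_sum_erase _ _ hk', ← Finset.add_sum_erase _ _ hk']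
  simp only [Function.update_self, if_true, hK, if_false, zero_add]
  rw [add_comm]
  congr 1
  refine Finset.sum_congr rfl fun o ho => ?_
  rw [Function.update_of_ne (Finset.ne_of_mem_erase ho)]

theorem movedSum_update {n k : ℕ} (hk : k < n) {K : ℕ → ℕ} (hK : K k ≠ 1) (w : ℕ → M) :
    movedSum n (Function.update K k 1) w + w k = movedSum n K w := by
  have hk' : k ∈ Finset.range n := Finset.mem_range.2 hk
  rw [movedSum, movedSum, ← Finset.add_sum_erase _ _ hk', ← Finset.add_sum_erase _ _ hk']
  simp only [Function.update_self, if_true, hK, if_false, zero_add]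
  rw [add_comm]
  congr 1
  refine Finset.sum_congr rfl fun o ho => ?_
  rw [Function.update_of_ne (Finset.ne_of_mem_erase ho)]

end BitVectors

/-! ### The knapsack recursion -/

open Classical in
/-- The least weight of a set of indices below `k` that remains after the removal of indices whose
sizes add up to at most `v`. -/
noncomputable def knapsack (w : ℕ → ℝ) (d : ℕ → ℕ) : ℕ → ℕ → ℝ
  | 0, _ => 0
  | k + 1, v =>
    if d k ≤ v ∧ knapsack w d k (v - d k) ≤ knapsack w d k v + w k then
      knapsack w d k (v - d k)
    else knapsack w d k v + w k

/-- Only optimality of the recursion is needed here, by induction on the last item. That its value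
is attained is shown by the backtracking. -/
theorem knapsack_le (w : ℕ → ℝ) (d : ℕ → ℕ) (K : ℕ → ℕ) (k v : ℕ) (h : movedSum k K d ≤ v) :
    knapsack w d k v ≤ keptSum k K w := by
  induction k generalizing v with
  | zero => simp [knapsack, keptSum]
  | succ k ih =>
    rw [movedSum_succ] at h
    rw [keptSum_succ, knapsack]
    by_cases hK : K k = 1
    · simp only [hK, if_true, add_zero] at h ⊢
      have := ih v h
      split_ifs with h'
      · linarith [h'.2]
      · linarith
    · simp only [hK, if_false, add_zero] at h ⊢
      have := ih (v - d k) (by omega)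
      split_ifs with h'
      · exact this
      · rw [not_and, not_le] at h'
        linarith [h' (by omega)]

/-! ### EF1 as a linear constraint -/

/-- The weights for the test of envy-freeness up to the item `g`. -/
def discounted (u : ℕ → ℝ) (g o : ℕ) : ℝ := if o = g then u o else u o + u o

/-- The agent who owns the items with `K o = 1` is envy-free up to one item. -/
def KeptEF1 (m : ℕ) (u : ℕ → ℝ) (K : ℕ → ℕ) : Prop :=
  ∃ g, keptSum m K (discounted u g) ≤ 1

/-- With total cost `1`, the inequality `c(S) - c(g) ≤ c(O \ S)` becomes `2 c(S) - c(g) ≤ 1`, which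
is additive in `S` once `g` is fixed. -/
theorem keptSum_discounted_of_mem {m g : ℕ} (hg : g < m) {K : ℕ → ℕ} (hK : K g = 1)
    (u : ℕ → ℝ) : keptSum m K (discounted u g) = 2 * keptSum m K u - u g := by
  have hg' : g ∈ Finset.range m := Finset.mem_range.2 hg
  rw [keptSum, keptSum, ← Finset.add_sum_erase _ _ hg', ← Finset.add_sum_erase _ _ hg']
  have : ∑ o ∈ (Finset.range m).erase g, (if K o = 1 then discounted u g o else 0) =
      2 * ∑ o ∈ (Finset.range m).erase g, (if K o = 1 then u o else 0) := by
    rw [Finset.mul_sum]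
    refine Finset.sum_congr rfl fun o ho => ?_
    rw [discounted, if_neg (Finset.ne_of_mem_erase ho)]
    split_ifs <;> ring
  rw [this]
  simp only [hK, if_true, discounted]
  ring

/-- A guess outside the kept set only gives the stronger constraint `2 c(S) ≤ 1`. So the guess need
not be required to lie in the set. -/
theorem keptSum_discounted_of_not_mem {m g : ℕ} {K : ℕ → ℕ} (hK : g < m → K g ≠ 1)
    (u : ℕ → ℝ) : keptSum m K (discounted u g) = 2 * keptSum m K u := by
  rw [keptSum, keptSum, Finset.mul_sum]
  refine Finset.sum_congr rfl fun o ho => ?_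
  by_cases h : K o = 1
  · have : o ≠ g := by
      rintro rfl
      exact hK (Finset.mem_range.1 ho) h
    simp [h, discounted, this]
    ring
  · simp [h]

/-! ### Allocations to two agents -/

namespace ChoreInstance

variable {m : ℕ} (I : ChoreInstance 2 m)

/-- The costs of the items for agent `i`, as a function of the number of the item. -/
def itemCost (i : Fin 2) (o : ℕ) : ℝ := if h : o < m then I.cost i ⟨o, h⟩ else 0

theorem itemCost_nonneg (i : Fin 2) (o : ℕ) : 0 ≤ I.itemCost i o := by
  unfold itemCost
  split_ifs
  · exact I.cost_nonneg _ _
  · exact le_rfl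

@[simp] theorem itemCost_val (i : Fin 2) (o : Fin m) : I.itemCost i o = I.cost i o := by
  simp [itemCost]

theorem sum_itemCost (i : Fin 2) : ∑ o ∈ Finset.range m, I.itemCost i o = 1 := by
  rw [Finset.sum_range, ← I.cost_total i]
  simp

theorem costOf_bundle {n m : ℕ} (I : ChoreInstance n m) (A : Allocation n m) (i j : Fin n) :
    I.costOf i (A.bundle j) = ∑ o, if A o = j then I.cost i o else 0 := by
  rw [costOf, Allocation.bundle, Finset.sum_filter]

theorem socialCost_eq_sum {n m : ℕ} (I : ChoreInstance n m) (A : Allocation n m) :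
    I.socialCost A = ∑ o, I.cost (A o) o := by
  simp only [socialCost, costOf_bundle]
  rw [Finset.sum_comm]
  refine Finset.sum_congr rfl fun o _ => ?_
  simp

theorem costOf_bundle_add {p q : Fin 2} (hpq : p ≠ q) (A : Allocation 2 m) (i : Fin 2) :
    I.costOf i (A.bundle p) + I.costOf i (A.bundle q) = 1 := by
  rw [costOf_bundle, costOf_bundle, ← Finset.sum_add_distrib, ← I.cost_total i]
  refine Finset.sum_congr rfl fun o _ => ?_
  have : A o = p ∨ A o = q := by omega
  rcases this with h | h
  · simp [h, hpq]
  · simp [h, hpq.symm]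

/-- The condition of envy-freeness up to one item for a single agent. -/
theorem ef1_condition_iff {p q : Fin 2} (hpq : p ≠ q) (A : Allocation 2 m) {o : Fin m}
    (ho : o ∈ A.bundle p) :
    I.costOf p ((A.bundle p).erase o) ≤ I.costOf p (A.bundle q) ↔
      2 * I.costOf p (A.bundle p) - I.cost p o ≤ 1 := by
  have h₁ := I.costOf_bundle_add hpq A p
  have h₂ : I.costOf p ((A.bundle p).erase o) + I.cost p o = I.costOf p (A.bundle p) :=
    Finset.sum_erase_add _ _ ho
  constructor <;> intro h <;> linarith

theorem isEF1_iff {p q : Fin 2} (hpq : p ≠ q) (A : Allocation 2 m) :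
    I.IsEF1 A ↔
      (A.bundle p = ∅ ∨ ∃ o ∈ A.bundle p, 2 * I.costOf p (A.bundle p) - I.cost p o ≤ 1) ∧
      (A.bundle q = ∅ ∨ ∃ o ∈ A.bundle q, 2 * I.costOf q (A.bundle q) - I.cost q o ≤ 1) := by
  constructor
  · intro h
    refine ⟨(h p q).imp_right ?_, (h q p).imp_right ?_⟩
    · rintro ⟨o, ho, h'⟩
      exact ⟨o, ho, (I.ef1_condition_iff hpq A ho).1 h'⟩
    · rintro ⟨o, ho, h'⟩
      exact ⟨o, ho, (I.ef1_condition_iff hpq.symm A ho).1 h'⟩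
  · rintro ⟨hp, hq⟩ i j
    by_cases hij : i = j
    · subst hij
      -- The definition also ranges over `i = j`, where nonnegative costs make the condition
      -- automatic.
      rcases (A.bundle i).eq_empty_or_nonempty with he | ⟨o, ho⟩
      · exact .inl he
      · exact .inr ⟨o, ho, Finset.sum_le_sum_of_subset_of_nonneg (Finset.erase_subset _ _)
          fun _ _ _ => I.cost_nonneg _ _⟩
    · have : (i = p ∧ j = q) ∨ (i = q ∧ j = p) := by omega
      rcases this with ⟨rfl, rfl⟩ | ⟨rfl, rfl⟩
      · refine hp.imp_right ?_
        rintro ⟨o, ho, h'⟩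
        exact ⟨o, ho, (I.ef1_condition_iff hpq A ho).2 h'⟩
      · refine hq.imp_right ?_
        rintro ⟨o, ho, h'⟩
        exact ⟨o, ho, (I.ef1_condition_iff hpq.symm A ho).2 h'⟩

/-- The allocation that gives the items with `K o = 1` to `p` and the other items to `q`. -/
def allocationOf (m : ℕ) (p q : Fin 2) (K : ℕ → ℕ) : Allocation 2 m :=
  fun o => if K o = 1 then p else q

theorem costOf_allocationOf_left {p q : Fin 2} (hpq : p ≠ q) (K : ℕ → ℕ) :
    I.costOf p ((allocationOf m p q K).bundle p) = keptSum m K (I.itemCost p) := by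
  rw [costOf_bundle, keptSum, Finset.sum_range]
  refine Finset.sum_congr rfl fun o _ => ?_
  by_cases h : K o = 1 <;> simp [allocationOf, h, hpq.symm]

theorem costOf_allocationOf_right {p q : Fin 2} (hpq : p ≠ q) (K : ℕ → ℕ) :
    I.costOf q ((allocationOf m p q K).bundle q) = movedSum m K (I.itemCost q) := by
  rw [costOf_bundle, movedSum, Finset.sum_range]
  refine Finset.sum_congr rfl fun o _ => ?_
  by_cases h : K o = 1 <;> simp [allocationOf, h, hpq]

theorem socialCost_allocationOf (p q : Fin 2) (K : ℕ → ℕ) :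
    I.socialCost (allocationOf m p q K) =
      keptSum m K (I.itemCost p) + movedSum m K (I.itemCost q) := by
  rw [socialCost_eq_sum, keptSum, movedSum, ← Finset.sum_add_distrib, Finset.sum_range]
  refine Finset.sum_congr rfl fun o _ => ?_
  by_cases h : K o = 1 <;> simp [allocationOf, h]

/-! ### Relaxation of an arbitrary EF1 allocation -/

/-- The bit vector of the items that agent `p` has and that the flags `f` assign to `p`. -/
def preferredBits {m : ℕ} (A : Allocation 2 m) (p : Fin 2) (f : ℕ → ℕ) (o : ℕ) : ℕ :=
  if h : o < m then if A ⟨o, h⟩ = p ∧ f o = 1 then 1 else 0 else 0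

theorem preferredBits_eq_one {A : Allocation 2 m} {p : Fin 2} {f : ℕ → ℕ} {o : ℕ} (h : o < m) :
    preferredBits A p f o = 1 ↔ A ⟨o, h⟩ = p ∧ f o = 1 := by
  simp [preferredBits, h]

/-- Only unflagged items change hands, from `p` to `q`, who finds them no more costly. -/
theorem cost_preferredBits_le {p q : Fin 2} (hpq : p ≠ q) {f : ℕ → ℕ}
    (h0 : ∀ o < m, f o ≠ 1 → I.itemCost q o ≤ I.itemCost p o) (A : Allocation 2 m) :
    keptSum m (preferredBits A p f) (I.itemCost p) +
      movedSum m (preferredBits A p f) (I.itemCost q) ≤ I.socialCost A := by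
  rw [← socialCost_allocationOf, socialCost_eq_sum, socialCost_eq_sum]
  refine Finset.sum_le_sum fun o _ => ?_
  have ho := preferredBits_eq_one (A := A) (p := p) (f := f) o.2
  unfold allocationOf
  split_ifs with h
  · rw [(ho.1 h).1]
  · by_cases hA : A o = p
    · have := h0 o o.2 fun hf => h (ho.2 ⟨hA, hf⟩)
      simpa [hA] using this
    · have : A o = q := by omega
      rw [this]

/-- Shrinking the bundle of `p` preserves EF1 for `p`. The item `g` of the given allocation still
serves as the guess, even if it has itself been handed over. -/
theorem keptEF1_preferredBits {p q : Fin 2} (hpq : p ≠ q) {f : ℕ → ℕ} {u : ℕ → ℝ}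
    (hu : ∀ o < m, u o = if f o = 1 then I.itemCost p o else 0) {A : Allocation 2 m}
    (hA : I.IsEF1 A) (hm : 0 < m) :
    ∃ g < m, keptSum m (preferredBits A p f) (discounted u g) ≤ 1 := by
  have hle : keptSum m (preferredBits A p f) u ≤ I.costOf p (A.bundle p) := by
    rw [costOf_bundle, keptSum, Finset.sum_range]
    refine Finset.sum_le_sum fun o _ => ?_
    rw [hu o o.2]
    have ho := preferredBits_eq_one (A := A) (p := p) (f := f) o.2
    have := I.cost_nonneg p o
    split_ifs with h₁ h₂ h₃ h₃ h₃ <;> simp_all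
  rcases ((I.isEF1_iff hpq A).1 hA).1 with he | ⟨g, hg, h⟩
  · refine ⟨0, hm, ?_⟩
    have : keptSum m (preferredBits A p f) (discounted u 0) = 0 := by
      refine Finset.sum_eq_zero fun o ho => if_neg fun h => ?_
      have := ((preferredBits_eq_one (Finset.mem_range.1 ho)).1 h).1
      have hmem : (⟨o, Finset.mem_range.1 ho⟩ : Fin m) ∈ A.bundle p := by
        simp [Allocation.bundle, this]
      simp [he] at hmem
    rw [this]
    exact zero_le_one
  · refine ⟨g, g.2, ?_⟩
    have hgA : A g = p := by simpa [Allocation.bundle] using hg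
    by_cases hf : f g = 1
    · rw [keptSum_discounted_of_mem g.2 ((preferredBits_eq_one g.2).2 ⟨hgA, hf⟩), hu g g.2,
        if_pos hf, itemCost_val]
      linarith
    -- Here `g` is unflagged and leaves the bundle, so the new cost is at most `c(A_p) - c(g)`, and
    -- twice that is at most `1 - c(g)`.
    · rw [keptSum_discounted_of_not_mem fun _ h => hf ((preferredBits_eq_one g.2).1 h).2]
      have : keptSum m (preferredBits A p f) u + I.cost p g ≤ I.costOf p (A.bundle p) := by
        rw [costOf_bundle, keptSum, Finset.sum_range,
          ← Finset.sum_erase_add _ _ (Finset.mem_univ g),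
          ← Finset.sum_erase_add (a := g) Finset.univ
            (fun o => if A o = p then I.cost p o else 0) (Finset.mem_univ g)]
        have hgb : preferredBits A p f g ≠ 1 := fun h => hf ((preferredBits_eq_one g.2).1 h).2
        simp only [hgb, if_false, add_zero, hgA, if_true, add_le_add_iff_right]
        refine Finset.sum_le_sum fun o _ => ?_
        rw [hu o o.2]
        have ho := preferredBits_eq_one (A := A) (p := p) (f := f) o.2
        have := I.cost_nonneg p o
        split_ifs with h₁ h₂ h₃ h₃ h₃ <;> simp_all
      linarith [I.cost_nonneg p g]

/-! ### Sufficient conditions for EF1, and the repair step -/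

/-- The properties of the bit vector that the algorithm computes imply envy-freeness up to one
item. -/
theorem isEF1_allocationOf {p q : Fin 2} (hpq : p ≠ q) {f K : ℕ → ℕ} {u : ℕ → ℝ}
    (hu : ∀ o < m, u o = if f o = 1 then I.itemCost p o else 0)
    (hq : movedSum m f (I.itemCost q) ≤ 1 / 2)
    (hKf : ∀ o < m, K o = 1 → f o = 1)
    (hp : KeptEF1 m u K)
    (hmoved : ∀ o < m, f o = 1 → K o ≠ 1 →
      2 * movedSum m K (I.itemCost q) - I.itemCost q o ≤ 1) :
    I.IsEF1 (allocationOf m p q K) := by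
  rw [I.isEF1_iff hpq, I.costOf_allocationOf_left hpq, I.costOf_allocationOf_right hpq]
  have hku : keptSum m K u = keptSum m K (I.itemCost p) := by
    refine Finset.sum_congr rfl fun o ho => ?_
    have ho := Finset.mem_range.1 ho
    split_ifs with h
    · rw [hu o ho, if_pos (hKf o ho h)]
    · rfl
  constructor
  · rcases ((allocationOf m p q K).bundle p).eq_empty_or_nonempty with he | ⟨o, ho⟩
    · exact .inl he
    refine .inr ?_
    have half : 2 * keptSum m K (I.itemCost p) ≤ 1 →
        ∃ o ∈ (allocationOf m p q K).bundle p,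
          2 * keptSum m K (I.itemCost p) - I.cost p o ≤ 1 :=
      fun h => ⟨o, ho, by linarith [I.cost_nonneg p o]⟩
    obtain ⟨g, hg⟩ := hp
    by_cases hgm : g < m ∧ K g = 1
    · obtain ⟨hgm, hK⟩ := hgm
      refine ⟨⟨g, hgm⟩, by simp [Allocation.bundle, allocationOf, hK], ?_⟩
      rw [keptSum_discounted_of_mem hgm hK, hku, hu g hgm, if_pos (hKf g hgm hK)] at hg
      simpa [itemCost, hgm] using hg
    · rw [keptSum_discounted_of_not_mem fun h h' => hgm ⟨h, h'⟩, hku] at hg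
      exact half hg
  · rcases ((allocationOf m p q K).bundle q).eq_empty_or_nonempty with he | ⟨o, ho⟩
    · exact .inl he
    refine .inr ?_
    -- If `q` has a flagged item, its removal suffices by `hmoved`. Otherwise `q` has exactly the
    -- unflagged items, and `hq` leaves no envy at all.
    by_cases hex : ∃ o < m, f o = 1 ∧ K o ≠ 1
    · obtain ⟨o, ho, hf, hK⟩ := hex
      refine ⟨⟨o, ho⟩, by simp [Allocation.bundle, allocationOf, hK], ?_⟩
      have h₃ : I.cost q ⟨o, ho⟩ = I.itemCost q o := by simp [itemCost, ho]
      rw [h₃]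
      exact hmoved o ho hf hK
    · push Not at hex
      have : movedSum m K (I.itemCost q) = movedSum m f (I.itemCost q) := by
        refine Finset.sum_congr rfl fun o ho => ?_
        have ho := Finset.mem_range.1 ho
        have h₁ := hKf o ho
        have h₂ := hex o ho
        by_cases h : K o = 1
        · simp [h, h₁ h]
        · rw [if_neg h, if_neg fun h' => h (h₂ h')]
      refine ⟨o, ho, ?_⟩
      linarith [I.cost_nonneg q o]

/-- Giving an item that makes the owner of the other items envious to the agent who prefers it
preserves that the latter is envy-free up to one item. -/
theorem keptEF1_update {m k : ℕ} (hk : k < m) {α β u : ℕ → ℝ} {f K : ℕ → ℕ} (hf : f k = 1)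
    (hu : ∀ o < m, u o = if f o = 1 then α o else 0) (hle : α k ≤ β k)
    (hKf : ∀ o < m, K o = 1 → f o = 1) (hK : K k ≠ 1)
    (hcost : keptSum m K α + movedSum m K β ≤ 1) (hy : 1 < 2 * movedSum m K β - β k) :
    KeptEF1 m u (Function.update K k 1) := by
  have hku : keptSum m K u = keptSum m K α := by
    refine Finset.sum_congr rfl fun o ho => ?_
    have ho := Finset.mem_range.1 ho
    split_ifs with h
    · rw [hu o ho, if_pos (hKf o ho h)]
    · rfl
  -- The new item itself is the one to remove: `2 α(K) + α k ≤ 2 (1 - β(moved)) + α k < 1 - β k + α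
  -- k ≤ 1`.
  refine ⟨k, ?_⟩
  rw [keptSum_discounted_of_mem hk (Function.update_self _ _ _), keptSum_update hk hK, hku,
    hu k hk, if_pos hf]
  linarith

/-! ### Rounding error -/

/-- A set of kept items whose rounded loss is optimal has an almost optimal cost. -/
theorem cost_le_of_rounded_le {m best : ℕ} {α β δ : ℕ → ℝ} {f K K' d : ℕ → ℕ} {ε : ℝ}
    (hm : 0 < m) (hε : 0 ≤ ε)
    (hδ : ∀ o < m, δ o = if f o = 1 then β o - α o else 0)
    (hd : ∀ o < m, d o * ε ≤ δ o * m ∧ δ o * m ≤ (d o + 1) * ε)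
    (hKf : ∀ o < m, K o = 1 → f o = 1) (hKf' : ∀ o < m, K' o = 1 → f o = 1)
    (hK : movedSum m K d ≤ best) (hK' : best ≤ movedSum m K' d) :
    keptSum m K α + movedSum m K β ≤ keptSum m K' α + movedSum m K' β + ε := by
  have hm' : (0 : ℝ) < m := by exact_mod_cast hm
  -- The social cost is that of giving every flagged item to `p`, plus the losses of the flagged
  -- items given up.
  have key : ∀ L : ℕ → ℕ, (∀ o < m, L o = 1 → f o = 1) →
      keptSum m L α + movedSum m L β = keptSum m f α + movedSum m f β + movedSum m L δ := by
    intro L hL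
    simp only [keptSum, movedSum, ← Finset.sum_add_distrib]
    refine Finset.sum_congr rfl fun o ho => ?_
    have ho := Finset.mem_range.1 ho
    have := hL o ho
    rw [hδ o ho]
    by_cases h : L o = 1
    · simp [h, this h]
    · by_cases h' : f o = 1 <;> simp [h, h']
  -- Everything is scaled by `m`, so each item contributes a rounding error of at most `ε`, and the
  -- division by `m` comes last.
  have h₁ : movedSum m K δ * m ≤ (movedSum m K d : ℕ) * ε + m * ε := by
    have : (m : ℝ) * ε = ∑ o ∈ Finset.range m, ε := by simp
    rw [this]
    simp only [movedSum, Finset.sum_mul, Nat.cast_sum, ← Finset.sum_add_distrib]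
    refine Finset.sum_le_sum fun o ho => ?_
    have := (hd o (Finset.mem_range.1 ho)).2
    split_ifs
    · simpa using hε
    · linarith
  have h₂ : (movedSum m K' d : ℕ) * ε ≤ movedSum m K' δ * m := by
    simp only [movedSum, Finset.sum_mul, Nat.cast_sum]
    refine Finset.sum_le_sum fun o ho => ?_
    have := (hd o (Finset.mem_range.1 ho)).1
    split_ifs
    · simp
    · exact this
  have h₃ : ((movedSum m K d : ℕ) : ℝ) * ε ≤ (movedSum m K' d : ℕ) * ε :=
    mul_le_mul_of_nonneg_right (by exact_mod_cast hK.trans hK') hε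
  have h₄ : movedSum m K δ * m ≤ (movedSum m K' δ + ε) * m := by linarith
  have := le_of_mul_le_mul_right h₄ hm'
  rw [key K hKf, key K' hKf']
  linarith

end ChoreInstance

namespace RealRAM

theorem State.putNat_nat_self (s : State) (a i v : ℕ) :
    (s.putNat a i v).nat a = Function.update (s.nat a) i v := by
  simp [State.putNat]

/-- Equality of natural numbers. -/
def Test.natEq (e f : NExpr) : Test := .and (.natLe e f) (.natLe f e)

@[simp] theorem Test.holds_natEq (e f : NExpr) (s : State) :
    (Test.natEq e f).Holds s ↔ e.eval s = f.eval s := by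
  simp [Test.natEq, Test.Holds, le_antisymm_iff]

/-- The cell of the natural number array `a` whose index is in the cell `0` of the array `i`. -/
def NExpr.at (a i : ℕ) : NExpr := .get a (.var i)

@[simp] theorem NExpr.eval_at (a i : ℕ) (s : State) :
    (NExpr.at a i).eval s = s.nat a (s.nat i 0) := rfl

/-- The cell `0` of the real array `a`. -/
def RExpr.var (a : ℕ) : RExpr := .get a (.const 0)

@[simp] theorem RExpr.eval_var (a : ℕ) (s : State) : (RExpr.var a).eval s = s.real a 0 := rfl

/-- The cell of the real array `a` whose index is in the cell `0` of the natural number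
array `i`. -/
def RExpr.at (a i : ℕ) : RExpr := .get a (.var i)

@[simp] theorem RExpr.eval_at (a i : ℕ) (s : State) :
    (RExpr.at a i).eval s = s.real a (s.nat i 0) := rfl

/-- The real number `1`. -/
def RExpr.one : RExpr := .ofNat (.const 1)

@[simp] theorem RExpr.eval_one (s : State) : RExpr.one.eval s = 1 := by
  simp [RExpr.one, RExpr.eval, NExpr.eval]

/-! ### The algorithm

Natural number arrays: `0` number of items, `1` output, `2` number of grid steps, `3`, `4`, `5`
counters, `6` items that the first agent of the oriented instance prefers, `7` rounded losses,
`8` items that this agent keeps, `9` best budget, `10` budget, `11` start of a row of the table,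
`12` number of the first agent of the oriented instance, `13` length of a row, `14` item.

Real arrays: `0` accuracy, `1`, `2` costs, `3`, `4` costs in the oriented instance, `5` table,
`6` and `9` sums and weights, `7` costs of the preferred items, `8` their losses. -/

/-! ### Grid size and orientation of the instance -/

/-- Compute the number of grid steps. -/
def gridProgram : Program :=
  .seq
    (.loop (.not (.realLe (.ofNat (.var 0)) (.mul (.ofNat (.var 2)) (.var 0))))
      (.setNat 2 (.const 0) (.add (.var 2) (.const 1))))
    (.setNat 13 (.const 0) (.add (.var 2) (.const 1)))

/-- The machine cannot round, so the ceiling is found by counting up to the first `N` with `m ≤ N *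
ε`. -/
theorem gridProgram_spec {s : State} {m : ℕ} {ε : ℝ} (hm : s.nat 0 0 = m) (hN : s.nat 2 0 = 0)
    (hε : s.real 0 0 = ε) (hpos : 0 < ε) :
    Ends gridProgram s (⌈m / ε⌉₊ * 20 + 20) fun s' =>
      s'.nat 2 0 = ⌈m / ε⌉₊ ∧ s'.nat 13 0 = ⌈m / ε⌉₊ + 1 := by
  refine ((Ends.loop (n := ⌈m / ε⌉₊) (k := 7) (fun i s' => s'.nat 2 0 = i) hN ?_ ?_).seq
    (n₂ := 8) (fun s' hf hs' => ?_)).imp ?_ fun _ _ h => h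
  · intro i s' hi hf hs'
    have h1 : s'.nat 0 0 = m := by rw [hf.1 0 rfl, hm]
    have h2 : s'.real 0 0 = ε := by rw [hf.2 0 rfl, hε]
    constructor
    · have := Nat.lt_ceil.1 hi
      rw [lt_div_iff₀ hpos] at this
      simpa [Test.Holds, RExpr.eval, h1, h2, hs'] using this
    · exact Ends.of_exec (by trivial) (by decide) (by simp [Program.exec, NExpr.eval, hs'])
  · intro s' hf hs'
    have h1 : s'.nat 0 0 = m := by rw [hf.1 0 rfl, hm]
    have h2 : s'.real 0 0 = ε := by rw [hf.2 0 rfl, hε]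
    have := Nat.le_ceil ((m : ℝ) / ε)
    rw [div_le_iff₀ hpos] at this
    simpa [Test.Holds, RExpr.eval, h1, h2, hs'] using this
  · exact Ends.of_exec (by trivial) (by decide) (by simp [Program.exec, NExpr.eval, hs'])
  · simp only [Test.steps, RExpr.steps, NExpr.steps, NExpr.var, RExpr.var]
    omega

/-- Compute the cost for the first agent of the items that are cheaper for this agent. -/
def balanceProgram : Program :=
  .for 3 0 (.ite (.realLe (.at 2 3) (.at 1 3)) .skip
    (.setReal 6 (.const 0) (.add (.var 6) (.at 1 3))))

theorem balanceProgram_spec {s : State} {m : ℕ} (hm : s.nat 0 0 = m) (h0 : s.real 6 0 = 0) :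
    Ends balanceProgram s ((m + 1) * 100) fun s' =>
      s'.real 6 0 = ∑ o ∈ Finset.range m, if s.real 2 o ≤ s.real 1 o then 0 else s.real 1 o := by
  refine (Ends.for (k := 86) (fun i s' => s'.real 6 0 =
      ∑ o ∈ Finset.range i, if s.real 2 o ≤ s.real 1 o then 0 else s.real 1 o)
    (by decide) rfl rfl hm (fun i s' v h => h) (by simpa using h0) ?_).imp
    le_rfl fun _ _ h => h
  intro i s' hi hc hf hI
  have h1 : s'.real 1 = s.real 1 := hf.2 1 rfl
  have h2 : s'.real 2 = s.real 2 := hf.2 2 rfl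
  refine Ends.of_exec (by simp [Program.LoopFree]) (by decide) ?_
  rw [Finset.sum_range_succ, ← hI]
  by_cases h : s.real 2 i ≤ s.real 1 i <;>
    simp [Program.exec, Test.Holds, RExpr.eval, NExpr.eval, hc, h1, h2, h]

/-- Copy the costs in the real arrays `a` and `b`; the test decides whether the first of the two
agents gets an item. -/
def orientProgram (a b : ℕ) (t : Test) : Program :=
  .for 3 0 (.seq (.setReal 3 (.var 3) (.at a 3)) (.seq (.setReal 4 (.var 3) (.at b 3))
    (.ite t
      (.seq (.setNat 6 (.var 3) (.const 1)) (.seq (.setReal 7 (.var 3) (.at 3 3))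
        (.setReal 8 (.var 3) (.sub (.at 4 3) (.at 3 3)))))
      (.seq (.setNat 6 (.var 3) (.const 0)) (.seq (.setReal 7 (.var 3) (.ofNat (.const 0)))
        (.setReal 8 (.var 3) (.ofNat (.const 0))))))))

open Classical in
theorem orientProgram_spec {a b : ℕ} {t : Test} {s : State} {m : ℕ} (c : ℕ → Prop)
    (ha : a = 1 ∨ a = 2) (hb : b = 1 ∨ b = 2) (ht : t.steps ≤ 20) (hm : s.nat 0 0 = m)
    (hc : ∀ s' : State, s'.real 1 = s.real 1 → s'.real 2 = s.real 2 →
      (t.Holds s' ↔ c (s'.nat 3 0))) :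
    Ends (orientProgram a b t) s ((m + 1) * 200) fun s' => ∀ o < m,
      s'.real 3 o = s.real a o ∧ s'.real 4 o = s.real b o ∧
      (s'.nat 6 o = if c o then 1 else 0) ∧ (s'.real 7 o = if c o then s.real a o else 0) ∧
      (s'.real 8 o = if c o then s.real b o - s.real a o else 0) := by
  refine (Ends.for (k := 186) (fun i s' => ∀ o < i,
      s'.real 3 o = s.real a o ∧ s'.real 4 o = s.real b o ∧
      (s'.nat 6 o = if c o then 1 else 0) ∧ (s'.real 7 o = if c o then s.real a o else 0) ∧
      (s'.real 8 o = if c o then s.real b o - s.real a o else 0))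
    (by decide) rfl rfl hm ?_ (by simp) ?_).imp le_rfl fun _ _ h => h
  · intro i s' v h
    simpa using h
  intro i s' hi hi' hf hI
  have h1 : s'.real 1 = s.real 1 := hf.2 1 rfl
  have h2 : s'.real 2 = s.real 2 := hf.2 2 rfl
  have hsa : s'.real a = s.real a := by rcases ha with rfl | rfl <;> assumption
  have hsb : s'.real b = s.real b := by rcases hb with rfl | rfl <;> assumption
  have ha3 : a ≠ 3 := by omega
  have hb3 : b ≠ 3 := by omega
  have hb4 : b ≠ 4 := by omega
  -- The test is evaluated after the writes to the arrays `3` and `4`; `hc` applies because the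
  -- arrays `1` and `2` are intact.
  have hT := hc ((s'.putReal 3 i (s.real a i)).putReal 4 i (s.real b i))
    (by ext; simp [h1]) (by ext; simp [h2])
  have hT' : (((s'.putReal 3 i (s.real a i)).putReal 4 i (s.real b i)).nat 3 0) = i := hi'
  rw [hT'] at hT
  refine Ends.of_exec (by simp [Program.LoopFree]) ?_ ?_
  · simp only [Program.size, RExpr.steps, NExpr.steps, NExpr.var, RExpr.at]
    omega
  · intro o ho
    rcases Nat.lt_succ_iff_lt_or_eq.1 ho with h | rfl
    · have := hI o h
      by_cases hci : c i <;>
        simpa [Program.exec, RExpr.eval, NExpr.eval, hi', h.ne, hsa, hsb, hT, hci, hb3]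
          using this
    · by_cases hci : c o <;>
        simp [Program.exec, RExpr.eval, NExpr.eval, hi', hsa, hsb, hT, hci, hb3]

/-! ### Rounding by counting -/

/-- Round the losses down to multiples of the grid step. -/
def roundProgram : Program :=
  .for 3 0 (.seq (.setNat 7 (.var 3) (.const 0))
    (.for 4 2 (.ite (.realLe (.mul (.add (.ofNat (.at 7 3)) .one) (.var 0))
        (.mul (.at 8 3) (.ofNat (.var 0))))
      (.setNat 7 (.var 3) (.add (.at 7 3) (.const 1))) .skip)))

theorem roundProgram_spec {s : State} {m N : ℕ} {ε : ℝ} (hm : s.nat 0 0 = m)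
    (hN : s.nat 2 0 = N) (hε : s.real 0 0 = ε) (hpos : 0 < ε) (h0 : ∀ o < m, 0 ≤ s.real 8 o)
    (h1 : ∀ o < m, s.real 8 o * m ≤ N * ε) :
    Ends roundProgram s ((m + 1) * ((N + 1) * 100 + 30)) fun s' => ∀ o < m,
      s'.nat 7 o * ε ≤ s.real 8 o * m ∧ s.real 8 o * m ≤ (s'.nat 7 o + 1) * ε := by
  refine (Ends.for (k := (N + 1) * 100 + 16) (fun i s' => ∀ o < i,
      s'.nat 7 o * ε ≤ s.real 8 o * m ∧ s.real 8 o * m ≤ (s'.nat 7 o + 1) * ε)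
    (by decide) rfl rfl hm ?_ (by simp) ?_).imp le_rfl fun _ _ h => h
  · intro i s' v h
    simpa using h
  intro i s' hi hi' hf hI
  have hd : s'.real 8 = s.real 8 := hf.2 8 rfl
  have hN' : s'.nat 2 0 = N := by rw [hf.1 2 rfl, hN]
  refine (Ends.seq (n₁ := 10) (n₂ := (N + 1) * (86 + 14)) (p := fun s₁ =>
    s₁.nat 7 i = 0 ∧ ∀ o < i, s₁.nat 7 o = s'.nat 7 o) (Ends.of_exec (by trivial) (by decide) ?_)
      fun s₁ hf₁ hs₁ => ?_).imp (by omega) fun _ _ h => h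
  · refine ⟨by simp [Program.exec, NExpr.eval, hi'], fun o ho => ?_⟩
    simp [Program.exec, hi', ho.ne]
  have hm₁ : s₁.nat 0 0 = m := by rw [hf₁.1 0 rfl, hf.1 0 rfl, hm]
  have hN₁ : s₁.nat 2 0 = N := by rw [hf₁.1 2 rfl, hN']
  have hi₁ : s₁.nat 3 0 = i := by rw [hf₁.1 3 rfl, hi']
  -- Either the counter has advanced in every round so far, or the upper bound has been reached.
  -- After `N` rounds the first case gives the bound too, by `h1`.
  refine (Ends.for (fun j s₂ => (∀ o < i, s₂.nat 7 o = s'.nat 7 o) ∧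
      s₂.nat 7 i * ε ≤ s.real 8 i * m ∧
      (s₂.nat 7 i = j ∨ s.real 8 i * m ≤ (s₂.nat 7 i + 1) * ε))
    (by decide) rfl rfl hN₁ ?_ ?_ ?_).imp le_rfl ?_
  · intro i s' v h
    simpa using h
  · refine ⟨hs₁.2, ?_, .inl hs₁.1⟩
    rw [hs₁.1]
    simpa using mul_nonneg (h0 i hi) (Nat.cast_nonneg m)
  · rintro j s₂ hj hj' hf₂ ⟨hlow, hle, hor⟩
    have hm₂ : s₂.nat 0 0 = m := by rw [hf₂.1 0 rfl, hm₁]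
    have hi₂ : s₂.nat 3 0 = i := by rw [hf₂.1 3 rfl, hi₁]
    have hε₂ : s₂.real 0 0 = ε := by rw [hf₂.2 0 rfl, hf₁.2 0 rfl, hf.2 0 rfl, hε]
    have hd₂ : s₂.real 8 = s.real 8 := by rw [hf₂.2 8 rfl, hf₁.2 8 rfl, hd]
    refine Ends.of_exec (by simp [Program.LoopFree]) (by decide) ?_
    by_cases h : ((s₂.nat 7 i : ℝ) + 1) * ε ≤ s.real 8 i * m
    · simp only [Program.exec, Test.Holds, RExpr.eval, NExpr.eval, RExpr.eval_one,
        NExpr.eval_at, NExpr.eval_var, RExpr.eval_at, RExpr.eval_var, hi₂, hε₂, hm₂, hd₂, h,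
        if_true, State.putNat_nat]
      refine ⟨fun o ho => by simpa [ho.ne] using hlow o ho, by simpa using h, ?_⟩
      rcases hor with h' | h'
      · left; simp [h']
      -- The upper bound is not strict, so the counter can still advance when the loss is an exact
      -- multiple of the grid step; the bound survives.
      · right
        have : s.real 8 i * m = (s₂.nat 7 i + 1) * ε := le_antisymm h' h
        rw [this]
        simp
        nlinarith
    · simp only [Program.exec, Test.Holds, RExpr.eval, RExpr.eval_one,
        NExpr.eval_at, NExpr.eval_var, RExpr.eval_at, RExpr.eval_var, hi₂, hε₂, hm₂, hd₂, h,
        if_false]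
      exact ⟨hlow, hle, .inr (not_le.1 h).le⟩
  · rintro s₂ _ ⟨hlow, hle, hor⟩ o ho
    rcases Nat.lt_succ_iff_lt_or_eq.1 ho with h | rfl
    · rw [hlow o h]
      exact hI o h
    · refine ⟨hle, ?_⟩
      rcases hor with h | h
      · rw [h]
        have := h1 o hi
        nlinarith
      · exact h

/-! ### The knapsack table -/

/-- Store the weight of the item in the array `k`, discounted for the item in the array `5`. -/
def weightProgram (k : ℕ) : Program :=
  .seq (.setReal 9 (.const 0) (.at 7 k))
    (.ite (.natEq (.var k) (.var 5)) .skip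
      (.setReal 9 (.const 0) (.add (.var 9) (.var 9))))

theorem weightProgram_exec (k : ℕ) (s : State) :
    ((weightProgram k).exec s).nat = s.nat ∧
      (∀ a, a ≠ 9 → ((weightProgram k).exec s).real a = s.real a) ∧
      ((weightProgram k).exec s).real 9 0 = discounted (s.real 7) (s.nat 5 0) (s.nat k 0) := by
  by_cases h : s.nat k 0 = s.nat 5 0
  · refine ⟨by simp [weightProgram, Program.exec, h], fun a ha => ?_, ?_⟩
    · ext j
      simp [weightProgram, Program.exec, h, ha]
    · simp [weightProgram, Program.exec, NExpr.eval, h, discounted]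
  · refine ⟨by simp [weightProgram, Program.exec, h], fun a ha => ?_, ?_⟩
    · ext j
      simp [weightProgram, Program.exec, h, ha]
    · simp [weightProgram, Program.exec, RExpr.eval, NExpr.eval, h, discounted]

/-- The entry of the current row of the table for the budget in the array `v`, reduced by the
loss of the item in the array `k`. -/
def movedEntry (k v : ℕ) : RExpr := .get 5 (.add (.var 11) (.sub (.var v) (.at 7 k)))

/-- The entry of the current row of the table for the budget in the array `v`, increased by the
weight of the current item. -/
def keptEntry (v : ℕ) : RExpr := .add (.get 5 (.add (.var 11) (.var v))) (.var 9)

/-- Whether the item in the array `k` is moved for the budget in the array `v`. -/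
def moveTest (k v : ℕ) : Test :=
  .and (.natLe (.at 7 k) (.var v)) (.realLe (movedEntry k v) (keptEntry v))

/-- Fill the table of the knapsack recursion. -/
def fillProgram : Program :=
  .seq (.setNat 11 (.const 0) (.const 0))
    (.seq (.for 4 13 (.setReal 5 (.var 4) (.ofNat (.const 0))))
      (.for 3 0 (.seq (weightProgram 3)
        (.seq (.for 4 13 (.ite (moveTest 3 4)
            (.setReal 5 (.add (.add (.var 11) (.var 13)) (.var 4)) (movedEntry 3 4))
            (.setReal 5 (.add (.add (.var 11) (.var 13)) (.var 4)) (keptEntry 4))))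
          (.setNat 11 (.const 0) (.add (.var 11) (.var 13)))))))

/-- The table is stored row by row in one array; writing row `k + 1` touches no earlier row. -/
theorem add_lt_of_row_lt {k k' v W : ℕ} (hk : k' ≤ k) (hv : v < W) (v' : ℕ) :
    k' * W + v < k * W + W + v' := by
  have := Nat.mul_le_mul_right W hk
  omega

/-- All rows are kept because the backtracking reads them again. The start of the current row is
maintained by addition, as the machine does not multiply integers. -/
theorem fillProgram_spec {s : State} {m W : ℕ} (hm : s.nat 0 0 = m) (hW : s.nat 13 0 = W) :
    Ends fillProgram s ((m + 1) * ((W + 1) * 100 + 100) + (W + 1) * 100) fun s' =>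
      s'.nat 11 0 = m * W ∧ ∀ k ≤ m, ∀ v < W,
        s'.real 5 (k * W + v) =
          knapsack (discounted (s.real 7) (s.nat 5 0)) (s.nat 7) k v := by
  set w := discounted (s.real 7) (s.nat 5 0) with hw
  set d := s.nat 7 with hd
  refine (Ends.seq (n₁ := 3) (p := fun s₁ => s₁.nat 11 0 = 0)
    (Ends.of_exec (by trivial) (by decide) (by simp [Program.exec, NExpr.eval]))
    fun s₁ hf₁ hs₁ => ?_).imp (n := 3 + ((W + 1) * (20 + 14) +
      (m + 1) * (((W + 1) * (86 + 14) + 50) + 14))) (by nlinarith) fun _ _ h => h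
  have hW₁ : s₁.nat 13 0 = W := by rw [hf₁.1 13 rfl, hW]
  refine (Ends.for (fun j s₂ => ∀ v < j, s₂.real 5 v = 0) (by decide) rfl rfl hW₁
    (fun i s' v h => h) (by simp) fun j s₂ hj hj' hf₂ hI => ?_).seq fun s₂ hf₂ hs₂ => ?_
  · refine Ends.of_exec (by trivial) (by decide) fun v hv => ?_
    rcases Nat.lt_succ_iff_lt_or_eq.1 hv with h | rfl
    · simpa [Program.exec, RExpr.eval, NExpr.eval, hj', h.ne] using hI v h
    · simp [Program.exec, RExpr.eval, NExpr.eval, hj']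
  have hm₂ : s₂.nat 0 0 = m := by rw [hf₂.1 0 rfl, hf₁.1 0 rfl, hm]
  refine (Ends.for (fun i s₃ => s₃.nat 11 0 = i * W ∧ ∀ k ≤ i, ∀ v < W,
        s₃.real 5 (k * W + v) = knapsack w d k v) (by decide) rfl rfl hm₂
    ?_ ?_ fun k s₃ hk hk' hf₃ hI => ?_)
  · intro i s' v h
    simpa using h
  · refine ⟨by rw [hf₂.1 11 rfl, hs₁, zero_mul], fun k hk v hv => ?_⟩
    obtain rfl : k = 0 := by omega
    simpa [knapsack] using hs₂ v hv
  obtain ⟨hbase, htab⟩ := hI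
  have hu₃ : s₃.real 7 = s.real 7 := by rw [hf₃.2 7 rfl, hf₂.2 7 rfl, hf₁.2 7 rfl]
  have hd₃ : s₃.nat 7 = d := by rw [hf₃.1 7 rfl, hf₂.1 7 rfl, hf₁.1 7 rfl]
  have hg₃ : s₃.nat 5 = s.nat 5 := by rw [hf₃.1 5 rfl, hf₂.1 5 rfl, hf₁.1 5 rfl]
  have hW₃ : s₃.nat 13 0 = W := by rw [hf₃.1 13 rfl, hf₂.1 13 rfl, hW₁]
  obtain ⟨hx₁, hx₂, hx₃⟩ := weightProgram_exec 3 s₃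
  rw [hu₃, hg₃, hk', ← hw] at hx₃
  refine (Ends.seq (n₁ := 40) (n₂ := (W + 1) * (86 + 14) + 10)
    (p := fun s₄ => s₄.nat = s₃.nat ∧ s₄.real 5 = s₃.real 5 ∧ s₄.real 9 0 = w k)
    (Ends.of_exec (by simp [Program.LoopFree, weightProgram]) (by decide)
      ⟨hx₁, hx₂ 5 (by decide), hx₃⟩) fun s₄ hf₄ hs₄ => ?_).imp (by omega) fun _ _ h => h
  obtain ⟨hn₄, hT₄, hw₄⟩ := hs₄
  refine Ends.seq (p := fun s₅ => (∀ k' ≤ k, ∀ v < W,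
        s₅.real 5 (k' * W + v) = knapsack w d k' v) ∧
      ∀ v < W, s₅.real 5 (k * W + W + v) = knapsack w d (k + 1) v) ?_
    fun s₅ hf₅ hs₅ => Ends.of_exec (by trivial) (by decide) ?_
  · refine Ends.for (n := W) (fun j s₅ => (∀ k' ≤ k, ∀ v < W,
        s₅.real 5 (k' * W + v) = knapsack w d k' v) ∧
      ∀ v < j, s₅.real 5 (k * W + W + v) = knapsack w d (k + 1) v) (by decide) rfl rfl
      (by rw [hn₄, hW₃]) (fun i s' v h => h) ⟨by rw [hT₄]; exact htab, by simp⟩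
      fun v s₅ hv hv' hf₅ hI => Ends.of_exec (by simp [Program.LoopFree]) (by decide) ?_
    obtain ⟨hI₁, hI₂⟩ := hI
    have e1 : s₅.nat 3 0 = k := by rw [hf₅.1 3 rfl, hn₄, hk']
    have e2 : s₅.nat 7 = d := by rw [hf₅.1 7 rfl, hn₄, hd₃]
    have e3 : s₅.nat 11 0 = k * W := by rw [hf₅.1 11 rfl, hn₄, hbase]
    have e4 : s₅.nat 13 0 = W := by rw [hf₅.1 13 rfl, hn₄, hW₃]
    have e5 : s₅.real 9 0 = w k := by rw [hf₅.2 9 rfl, hw₄]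
    have e6 := hI₁ k le_rfl v hv
    -- Truncated subtraction keeps the index inside the row even when `d k > v`, where the test
    -- fails anyway.
    have e7 := hI₁ k le_rfl (v - d k) (by omega)
    have hT : (moveTest 3 4).Holds s₅ ↔
        d k ≤ v ∧ knapsack w d k (v - d k) ≤ knapsack w d k v + w k := by
      simp [moveTest, movedEntry, keptEntry, Test.Holds, RExpr.eval, NExpr.eval, e1, e2, e3,
        hv', e5, e6, e7]
    have hval : (Program.ite (moveTest 3 4)
            (.setReal 5 (.add (.add (.var 11) (.var 13)) (.var 4)) (movedEntry 3 4))
            (.setReal 5 (.add (.add (.var 11) (.var 13)) (.var 4)) (keptEntry 4))).exec s₅ =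
        s₅.putReal 5 (k * W + W + v) (knapsack w d (k + 1) v) := by
      rw [Program.exec, knapsack]
      simp only [hT]
      split_ifs with h
      · simp [Program.exec, movedEntry, RExpr.eval, NExpr.eval, e1, e2, e3, e4, hv', e7]
      · simp [Program.exec, keptEntry, RExpr.eval, NExpr.eval, e3, e4, hv', e5, e6]
    rw [hval]
    refine ⟨fun k' hk' v' hv' => ?_, fun v' hv' => ?_⟩
    · have := add_lt_of_row_lt hk' hv' v
      simpa [this.ne] using hI₁ k' hk' v' hv'
    · rcases Nat.lt_succ_iff_lt_or_eq.1 hv' with h | rfl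
      · simpa [h.ne] using hI₂ v' h
      · simp
  · have e3 : s₅.nat 11 0 = k * W := by rw [hf₅.1 11 rfl, hn₄, hbase]
    have e4 : s₅.nat 13 0 = W := by rw [hf₅.1 13 rfl, hn₄, hW₃]
    refine ⟨by simp [Program.exec, NExpr.eval, e3, e4, Nat.succ_mul], fun k' hk' v hv => ?_⟩
    rcases Nat.lt_succ_iff_lt_or_eq.1 (Nat.lt_succ_of_le hk') with h | rfl
    · exact hs₅.1 k' (by omega) v hv
    · have := hs₅.2 v hv
      rw [Nat.succ_mul]
      exact this

/-- Find the least budget for which the last row of the table has an entry that is at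
most `1`. -/
def searchProgram : Program :=
  .seq (.setNat 10 (.const 0) (.const 0))
    (.for 4 2 (.ite (.realLe (.get 5 (.add (.var 11) (.var 10))) .one) .skip
      (.setNat 10 (.const 0) (.add (.var 10) (.const 1)))))

theorem searchProgram_spec {s : State} {N : ℕ} {T : ℕ → ℝ} (hN : s.nat 2 0 = N)
    (hT : ∀ v ≤ N, s.real 5 (s.nat 11 0 + v) = T v) (h1 : T N ≤ 1) :
    Ends searchProgram s ((N + 1) * 100) fun s' =>
      s'.nat 10 0 ≤ N ∧ T (s'.nat 10 0) ≤ 1 ∧ ∀ v < s'.nat 10 0, 1 < T v := by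
  refine (Ends.seq (n₁ := 3) (p := fun s₁ => s₁.nat 10 0 = 0)
    (Ends.of_exec (by trivial) (by decide) (by simp [Program.exec, NExpr.eval]))
    fun s₁ hf₁ hs₁ => ?_).imp (n := 3 + (N + 1) * (80 + 14)) (by omega) fun _ _ h => h
  have hN₁ : s₁.nat 2 0 = N := by rw [hf₁.1 2 rfl, hN]
  -- The budget stops advancing at the first entry that is at most `1`; `h1` ensures that there is
  -- one.
  refine (Ends.for (fun j s₂ => s₂.nat 10 0 ≤ j ∧ (s₂.nat 10 0 = j ∨ T (s₂.nat 10 0) ≤ 1) ∧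
    ∀ v < s₂.nat 10 0, 1 < T v) (by decide) rfl rfl hN₁
    ?_ (by simp [hs₁]) fun j s₂ hj hj' hf₂ hI => ?_).imp le_rfl ?_
  · intro i s' v h
    simpa using h
  · obtain ⟨hle, hor, hlt⟩ := hI
    have e : s₂.real 5 (s₂.nat 11 0 + s₂.nat 10 0) = T (s₂.nat 10 0) := by
      rw [hf₂.2 5 rfl, hf₂.1 11 rfl, hf₁.2 5 rfl, hf₁.1 11 rfl]
      exact hT _ (by omega)
    refine Ends.of_exec (by simp [Program.LoopFree]) (by decide) ?_
    by_cases h : T (s₂.nat 10 0) ≤ 1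
    · simp only [Program.exec, Test.Holds, RExpr.eval, NExpr.eval, NExpr.eval_var,
        RExpr.eval_one, e, h, if_true]
      exact ⟨by omega, .inr trivial, hlt⟩
    · have hj : s₂.nat 10 0 = j := hor.resolve_right h
      simp only [Program.exec, Test.Holds, RExpr.eval, NExpr.eval, NExpr.eval_var,
        RExpr.eval_one, e, h, if_false, State.putNat_nat, and_self, if_true]
      refine ⟨by omega, .inl (by omega), fun v hv => ?_⟩
      rcases Nat.lt_succ_iff_lt_or_eq.1 hv with h' | rfl
      · exact hlt v h'
      · exact not_le.1 h
  · rintro s₂ _ ⟨hle, hor, hlt⟩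
    refine ⟨hle, ?_, hlt⟩
    rcases hor with h | h
    · rw [h]; exact h1
    · exact h

/-- Reconstruct a set of kept items from the table. -/
def backtrackProgram : Program :=
  .for 3 0 (.seq (.setNat 14 (.const 0) (.sub (.var 0) (.add (.var 3) (.const 1))))
    (.seq (.setNat 11 (.const 0) (.sub (.var 11) (.var 13)))
      (.seq (weightProgram 14)
        (.ite (moveTest 14 10)
          (.seq (.setNat 8 (.var 14) (.const 0))
            (.setNat 10 (.const 0) (.sub (.var 10) (.at 7 14))))
          (.setNat 8 (.var 14) (.const 1))))))

/-- Replaying the decisions from the last row down yields a set that attains the table entry. Ties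
are decided in favour of moving, so items of zero loss and zero weight are never kept; this excludes
the unflagged items. -/
theorem backtrackProgram_spec {s : State} {m W : ℕ} {w : ℕ → ℝ} {d : ℕ → ℕ}
    (hm : s.nat 0 0 = m) (hW : s.nat 13 0 = W)
    (hw : w = discounted (s.real 7) (s.nat 5 0)) (hd : d = s.nat 7) (hv : s.nat 10 0 < W)
    (hbase : s.nat 11 0 = m * W)
    (htab : ∀ k ≤ m, ∀ v < W, s.real 5 (k * W + v) = knapsack w d k v) :
    Ends backtrackProgram s ((m + 1) * 200) fun s' =>
      keptSum m (s'.nat 8) w = knapsack w d m (s.nat 10 0) ∧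
      movedSum m (s'.nat 8) d ≤ s.nat 10 0 ∧
      ∀ o < m, s'.nat 8 o = 1 → ¬ (d o = 0 ∧ w o = 0) := by
  set v₀ := s.nat 10 0 with hv₀
  -- The entry at the remaining row and budget, plus the weight already kept, is constant; the
  -- remaining budget plus the loss already incurred stays below `v₀`.
  refine (Ends.for (k := 186) (fun i s' => ∃ k, k + i = m ∧ s'.nat 11 0 = k * W ∧
      s'.nat 10 0 ≤ v₀ ∧
      knapsack w d k (s'.nat 10 0) + ∑ o ∈ Finset.Ico k m, (if s'.nat 8 o = 1 then w o else 0) =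
        knapsack w d m v₀ ∧
      s'.nat 10 0 + ∑ o ∈ Finset.Ico k m, (if s'.nat 8 o = 1 then 0 else d o) ≤ v₀ ∧
      ∀ o < m, k ≤ o → s'.nat 8 o = 1 → ¬ (d o = 0 ∧ w o = 0))
    (by decide) rfl rfl hm ?_ ?_ fun i s' hi hi' hf hI => ?_).imp le_rfl ?_
  · intro i s' v h
    simpa using h
  · exact ⟨m, by omega, hbase, le_rfl, by simp [← hv₀], by simp [← hv₀], by omega⟩
  · obtain ⟨k', hk', hb, hle, hsumw, hsumd, hzero⟩ := hI
    obtain ⟨k, rfl⟩ : ∃ k, k' = k + 1 := ⟨k' - 1, by omega⟩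
    have f0 : s'.nat 0 0 = m := by rw [hf.1 0 rfl, hm]
    have f13 : s'.nat 13 0 = W := by rw [hf.1 13 rfl, hW]
    have f7 : s'.nat 7 = d := by rw [hf.1 7 rfl, hd]
    have f5 : s'.nat 5 0 = s.nat 5 0 := by rw [hf.1 5 rfl]
    have g7 : s'.real 7 = s.real 7 := hf.2 7 rfl
    have g5 : s'.real 5 = s.real 5 := hf.2 5 rfl
    have hk : m - (i + 1) = k := by omega
    have hbW : (k + 1) * W - W = k * W := by rw [Nat.succ_mul]; omega
    refine Ends.of_exec (by simp [Program.LoopFree, weightProgram]) (by decide) ?_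
    set s₁ := (s'.putNat 14 0 k).putNat 11 0 (k * W) with hs₁
    obtain ⟨hx₁, hx₂, hx₃⟩ := weightProgram_exec 14 s₁
    set s₂ := (weightProgram 14).exec s₁ with hs₂
    have hw₂ : s₂.real 9 0 = w k := by
      rw [hx₃, hw]; simp [hs₁, g7, f5]
    have n7 : s₂.nat 7 = d := by rw [hx₁]; ext; simp [hs₁, f7]
    have n14 : s₂.nat 14 0 = k := by rw [hx₁]; simp [hs₁]
    have n11 : s₂.nat 11 0 = k * W := by rw [hx₁]; simp [hs₁]
    have n10 : s₂.nat 10 0 = s'.nat 10 0 := by rw [hx₁]; simp [hs₁]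
    have n8 : s₂.nat 8 = s'.nat 8 := by rw [hx₁]; ext; simp [hs₁]
    have r5 : s₂.real 5 = s.real 5 := by rw [hx₂ 5 (by decide)]; exact g5
    have t1 := htab k (by omega) (s'.nat 10 0) (by omega)
    have t2 := htab k (by omega) (s'.nat 10 0 - d k) (by omega)
    have hT : (moveTest 14 10).Holds s₂ ↔ d k ≤ s'.nat 10 0 ∧
        knapsack w d k (s'.nat 10 0 - d k) ≤ knapsack w d k (s'.nat 10 0) + w k := by
      simp [moveTest, movedEntry, keptEntry, Test.Holds, RExpr.eval, NExpr.eval, n14, n7, n11,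
        n10, r5, hw₂, t1, t2]
    have hs₁' : Program.exec (.setNat 11 (.const 0) (.sub (.var 11) (.var 13)))
        (Program.exec (.setNat 14 (.const 0) (.sub (.var 0) (.add (.var 3) (.const 1)))) s') =
        s₁ := by
      simp [Program.exec, NExpr.eval, f0, hi', hk, hb, f13, hbW, hs₁]
    have hexec : ∀ D : Program, Program.exec
        (.seq (.setNat 14 (.const 0) (.sub (.var 0) (.add (.var 3) (.const 1))))
          (.seq (.setNat 11 (.const 0) (.sub (.var 11) (.var 13)))
            (.seq (weightProgram 14) D))) s' = D.exec s₂ := fun D => by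
      rw [hs₂, ← hs₁']; rfl
    rw [hexec, Program.exec]
    have hsplit : Finset.Ico k m = insert k (Finset.Ico (k + 1) m) := by
      ext o; simp; omega
    have hnot : k ∉ Finset.Ico (k + 1) m := by simp
    have hcongr : ∀ {M : Type} [AddCommMonoid M] (K : ℕ → ℕ) (x y : ℕ → M),
        (∀ o, k + 1 ≤ o → K o = s'.nat 8 o) →
        ∑ o ∈ Finset.Ico (k + 1) m, (if K o = 1 then x o else y o) =
          ∑ o ∈ Finset.Ico (k + 1) m, (if s'.nat 8 o = 1 then x o else y o) :=
      fun K x y h => Finset.sum_congr rfl fun o ho => by rw [h o (Finset.mem_Ico.1 ho).1]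
    split_ifs with h
    · rw [hT] at h
      set s₃ := Program.exec (.seq (.setNat 8 (.var 14) (.const 0))
            (.setNat 10 (.const 0) (.sub (.var 10) (.at 7 14)))) s₂ with hs₃
      have k8 : ∀ o, s₃.nat 8 o = if o = k then 0 else s'.nat 8 o := by
        intro o
        simp [hs₃, Program.exec, NExpr.eval, n14, n8]
      have k10 : s₃.nat 10 0 = s'.nat 10 0 - d k := by
        simp [hs₃, Program.exec, NExpr.eval, n14, n10, n7]
      have k11 : s₃.nat 11 0 = k * W := by
        simp [hs₃, Program.exec, NExpr.eval, n11]
      have hsame : ∀ o, k + 1 ≤ o → s₃.nat 8 o = s'.nat 8 o := fun o ho => by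
        rw [k8, if_neg (by omega)]
      refine ⟨k, by omega, k11, by omega, ?_, ?_, ?_⟩
      · rw [hsplit, Finset.sum_insert hnot, hcongr _ _ _ hsame, k10, k8, if_pos rfl,
          if_neg (by decide), zero_add, ← hsumw, knapsack, if_pos h]
      · rw [hsplit, Finset.sum_insert hnot, hcongr _ _ _ hsame, k10, k8, if_pos rfl,
          if_neg (by decide)]
        omega
      · intro o ho hko ho1
        rw [k8] at ho1
        split_ifs at ho1 with hok
        exact hzero o ho (by omega) ho1
    · rw [hT] at h
      set s₃ := Program.exec (.setNat 8 (.var 14) (.const 1)) s₂ with hs₃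
      have k8 : ∀ o, s₃.nat 8 o = if o = k then 1 else s'.nat 8 o := by
        intro o
        simp [hs₃, Program.exec, NExpr.eval, n14, n8]
      have k10 : s₃.nat 10 0 = s'.nat 10 0 := by
        simp [hs₃, Program.exec, n10]
      have k11 : s₃.nat 11 0 = k * W := by
        simp [hs₃, Program.exec, n11]
      have hsame : ∀ o, k + 1 ≤ o → s₃.nat 8 o = s'.nat 8 o := fun o ho => by
        rw [k8, if_neg (by omega)]
      refine ⟨k, by omega, k11, by omega, ?_, ?_, ?_⟩
      · rw [hsplit, Finset.sum_insert hnot, hcongr _ _ _ hsame, k10, k8, if_pos rfl,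
          if_pos rfl, ← hsumw, knapsack, if_neg h, add_assoc]
      · rw [hsplit, Finset.sum_insert hnot, hcongr _ _ _ hsame, k10, k8, if_pos rfl,
          if_pos rfl]
        omega
      · intro o ho hko ho1
        by_cases hok : o = k
        · rintro ⟨h1, h2⟩
          subst hok
          -- With zero loss and zero weight both inequalities of the test are equalities or trivial,
          -- so the item would have been moved.
          refine h ⟨by omega, ?_⟩
          simp [h1, h2]
        · rw [k8, if_neg hok] at ho1
          exact hzero o ho (by omega) ho1
  · rintro s' _ ⟨k, hk, -, -, hw', hd', hz⟩
    obtain rfl : k = 0 := by omega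
    rw [← Finset.range_eq_Ico] at hw' hd'
    simp only [knapsack, zero_add] at hw'
    exact ⟨hw', by simp only [movedSum]; omega, fun o ho => hz o ho (Nat.zero_le _)⟩

/-! ### Optimization over the guessed item -/

/-- Try all guesses of the item up to which the first agent is envy-free, and keep a set of items
with the least rounded loss. -/
def guessProgram : Program :=
  .for 5 0 (.seq fillProgram (.seq searchProgram
    (.ite (.natLe (.var 9) (.var 10)) .skip
      (.seq (.setNat 9 (.const 0) (.var 10)) backtrackProgram))))

/-- Keeping nothing is feasible for every guess and has rounded loss at most `N`, so it is a valid
initial candidate. Afterwards a set is replaced only for a strictly smaller budget. -/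
theorem guessProgram_spec {s : State} {m N : ℕ} {f : ℕ → ℕ} (hm : s.nat 0 0 = m)
    (hN : s.nat 2 0 = N) (hW : s.nat 13 0 = N + 1) (hbest : s.nat 9 0 = N)
    (hK : s.nat 8 = 0) (hd : ∑ o ∈ Finset.range m, s.nat 7 o ≤ N)
    (hf : ∀ o < m, f o ≠ 1 → s.nat 7 o = 0 ∧ s.real 7 o = 0) :
    Ends guessProgram s ((m + 1) * ((m + 1) * ((N + 2) * 600))) fun s' => ∃ best,
      KeptEF1 m (s.real 7) (s'.nat 8) ∧ movedSum m (s'.nat 8) (s.nat 7) ≤ best ∧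
      (∀ o < m, s'.nat 8 o = 1 → f o = 1) ∧
      ∀ g < m, ∀ K, keptSum m K (discounted (s.real 7) g) ≤ 1 →
        best ≤ movedSum m K (s.nat 7) := by
  set u := s.real 7 with hu
  set d := s.nat 7 with hd'
  refine (Ends.for (n := m) (k := (m + 1) * ((N + 2) * 100 + 100) + (N + 2) * 100 +
      ((N + 1) * 100 + (20 + (m + 1) * 200)))
    (fun g s' => s'.nat 9 0 ≤ N ∧ KeptEF1 m u (s'.nat 8) ∧
      movedSum m (s'.nat 8) d ≤ s'.nat 9 0 ∧ (∀ o < m, s'.nat 8 o = 1 → f o = 1) ∧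
      ∀ g' < g, ∀ K, keptSum m K (discounted u g') ≤ 1 → s'.nat 9 0 ≤ movedSum m K d)
    (by decide) rfl rfl hm ?_ ?_ fun g s' hg hg' hfr hI => ?_).imp ?_ ?_
  · intro i s' v h
    simp only [State.putNat_nat]
    exact h
  · refine ⟨hbest.le, ⟨0, ?_⟩, ?_, ?_, by simp⟩
    · rw [hK]; simp [keptSum]
    · rw [hK, hbest]; simpa [movedSum] using hd
    · rw [hK]; simp
  · obtain ⟨hbN, hE, hmv, hKf, hopt⟩ := hI
    have f0 : s'.nat 0 0 = m := by rw [hfr.1 0 rfl, hm]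
    have f2 : s'.nat 2 0 = N := by rw [hfr.1 2 rfl, hN]
    have f13 : s'.nat 13 0 = N + 1 := by rw [hfr.1 13 rfl, hW]
    have f7 : s'.nat 7 = d := hfr.1 7 rfl
    have g7 : s'.real 7 = u := hfr.2 7 rfl
    refine (fillProgram_spec f0 f13).seq fun s₁ hf₁ hs₁ => ?_
    rw [g7, hg', f7] at hs₁
    obtain ⟨hb₁, ht₁⟩ := hs₁
    set w := discounted u g with hw
    have hlast : knapsack w d m N ≤ 1 := by
      refine (knapsack_le w d 0 m N ?_).trans ?_
      · simpa [movedSum] using hd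
      · simp [keptSum]
    refine (searchProgram_spec (T := knapsack w d m) (by rw [hf₁.1 2 rfl, f2])
      (fun v hv => by rw [hb₁]; exact ht₁ m le_rfl v (by omega)) hlast).seq
      fun s₂ hf₂ hs₂ => ?_
    obtain ⟨hv₁, hv₂, hv₃⟩ := hs₂
    -- A feasible set of smaller rounded loss would force an earlier table entry to be at most `1`,
    -- against the minimality of the budget found.
    have hbelow : ∀ K, keptSum m K w ≤ 1 → s₂.nat 10 0 ≤ movedSum m K d := by
      intro K hK1
      by_contra! hlt
      have := hv₃ _ hlt
      linarith [knapsack_le w d K m _ le_rfl]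
    have e9 : s₂.nat 9 = s'.nat 9 := by rw [hf₂.1 9 rfl, hf₁.1 9 rfl]
    have e8 : s₂.nat 8 = s'.nat 8 := by rw [hf₂.1 8 rfl, hf₁.1 8 rfl]
    refine (Ends.ite (n₁ := 1) (n₂ := 5 + (m + 1) * 200) (fun h => ?_) fun h => ?_).imp
      (by simp only [Test.steps, NExpr.steps, NExpr.var]; omega) fun _ _ h => h
    · refine Ends.of_exec (by trivial) (by decide) ?_
      have h : s'.nat 9 0 ≤ s₂.nat 10 0 := by simpa [Test.Holds, e9] using h
      simp only [Program.exec, e8, e9]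
      refine ⟨hbN, hE, hmv, hKf, fun g' hg' K hK1 => ?_⟩
      rcases Nat.lt_succ_iff_lt_or_eq.1 hg' with h' | rfl
      · exact hopt g' h' K hK1
      · exact h.trans (hbelow K hK1)
    · have h : s₂.nat 10 0 < s'.nat 9 0 := by simpa [Test.Holds, e9] using h
      refine Ends.seq (p := fun s₃ => s₃.nat 9 0 = s₂.nat 10 0 ∧ s₃.nat 10 0 = s₂.nat 10 0)
        (Ends.of_exec (by trivial) (by decide) (by simp [Program.exec, NExpr.eval]))
        fun s₃ hf₃ hs₃ => ?_
      have i5 : s₃.nat 5 0 = g := by rw [hf₃.1 5 rfl, hf₂.1 5 rfl, hf₁.1 5 rfl, hg']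
      have i7 : s₃.nat 7 = d := by rw [hf₃.1 7 rfl, hf₂.1 7 rfl, hf₁.1 7 rfl, f7]
      have j7 : s₃.real 7 = u := by rw [hf₃.2 7 rfl, hf₂.2 7 rfl, hf₁.2 7 rfl, g7]
      refine (backtrackProgram_spec (m := m) (W := N + 1) (w := w) (d := d)
        (by rw [hf₃.1 0 rfl, hf₂.1 0 rfl, hf₁.1 0 rfl, f0])
        (by rw [hf₃.1 13 rfl, hf₂.1 13 rfl, hf₁.1 13 rfl, f13])
        (by rw [j7, i5]) i7.symm (by rw [hs₃.2]; omega)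
        (by rw [hf₃.1 11 rfl, hf₂.1 11 rfl, hb₁])
        (by rw [hf₃.2 5 rfl, hf₂.2 5 rfl]; exact ht₁)).imp le_rfl ?_
      rintro s₄ hf₄ ⟨hk₁, hk₂, hk₃⟩
      rw [hs₃.2] at hk₁ hk₂
      have e : s₄.nat 9 0 = s₂.nat 10 0 := by rw [hf₄.1 9 rfl, hs₃.1]
      rw [e]
      refine ⟨hv₁, ⟨g, by rw [← hw, hk₁]; exact hv₂⟩, hk₂, fun o ho hK1 => ?_,
        fun g' hg' K hK1 => ?_⟩
      · by_contra hfo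
        obtain ⟨h1, h2⟩ := hf o ho hfo
        exact hk₃ o ho hK1 ⟨h1, by simp [hw, discounted, h2]⟩
      · rcases Nat.lt_succ_iff_lt_or_eq.1 hg' with h' | rfl
        · exact h.le.trans (hopt g' h' K hK1)
        · exact hbelow K hK1
  · refine Nat.mul_le_mul_left _ ?_
    nlinarith [Nat.zero_le (m * N)]
  · rintro s' _ ⟨-, h⟩
    exact ⟨_, h⟩

/-! ### Making the second agent EF1 -/

/-- Let the first agent keep nothing if the social cost is larger than `1`. -/
def limitProgram : Program :=
  .seq (.setReal 6 (.const 0) (.ofNat (.const 0)))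
    (.seq (.for 3 0 (.ite (.natEq (.at 8 3) (.const 1))
        (.setReal 6 (.const 0) (.add (.var 6) (.at 3 3)))
        (.setReal 6 (.const 0) (.add (.var 6) (.at 4 3)))))
      (.ite (.realLe (.var 6) .one) .skip (.for 3 0 (.setNat 8 (.var 3) (.const 0)))))

/-- The repair needs social cost at most `1`. Giving everything to `q` costs exactly `1` by
normalization, so the replacement, made only above `1`, is an improvement. -/
theorem limitProgram_spec {s : State} {m : ℕ} (hm : s.nat 0 0 = m) :
    Ends limitProgram s ((m + 1) * 200) fun s' =>
      (s'.nat 8 = s.nat 8 ∧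
        keptSum m (s.nat 8) (s.real 3) + movedSum m (s.nat 8) (s.real 4) ≤ 1) ∨
      ((∀ o < m, s'.nat 8 o = 0) ∧
        1 < keptSum m (s.nat 8) (s.real 3) + movedSum m (s.nat 8) (s.real 4)) := by
  refine (Ends.seq (n₁ := 10) (p := fun s₁ => s₁.real 6 0 = 0)
    (Ends.of_exec (by trivial) (by decide) (by simp [Program.exec, RExpr.eval, NExpr.eval]))
    fun s₁ hf₁ hs₁ => ?_).imp (n := 10 + ((m + 1) * (80 + 14) +
      (20 + (1 + (m + 1) * (10 + 14))))) (by omega) fun _ _ h => h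
  have hm₁ : s₁.nat 0 0 = m := by rw [hf₁.1 0 rfl, hm]
  have a8 : s₁.nat 8 = s.nat 8 := hf₁.1 8 rfl
  have a3 : s₁.real 3 = s.real 3 := hf₁.2 3 rfl
  have a4 : s₁.real 4 = s.real 4 := hf₁.2 4 rfl
  refine (Ends.for (fun i s₂ => s₂.real 6 0 =
      keptSum i (s.nat 8) (s.real 3) + movedSum i (s.nat 8) (s.real 4))
    (by decide) rfl rfl hm₁ (fun i s' v h => h) (by simp [hs₁, keptSum, movedSum])
    fun i s₂ hi hi' hf₂ hI => ?_).seq fun s₂ hf₂ hs₂ => ?_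
  · have b8 : s₂.nat 8 = s.nat 8 := by rw [hf₂.1 8 rfl, a8]
    have b3 : s₂.real 3 = s.real 3 := by rw [hf₂.2 3 rfl, a3]
    have b4 : s₂.real 4 = s.real 4 := by rw [hf₂.2 4 rfl, a4]
    refine Ends.of_exec (by simp [Program.LoopFree]) (by decide) ?_
    rw [keptSum_succ, movedSum_succ]
    by_cases h : s.nat 8 i = 1
    · simp [Program.exec, RExpr.eval, NExpr.eval, hi', b8, b3, h, hI]
      ring
    · simp [Program.exec, RExpr.eval, NExpr.eval, hi', b8, b4, h, hI]
      ring
  · have hm₂ : s₂.nat 0 0 = m := by rw [hf₂.1 0 rfl, hm₁]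
    refine (Ends.ite (n₁ := 1) (n₂ := (m + 1) * (10 + 14)) (fun h => ?_) fun h => ?_).imp
      (Nat.add_le_add_right (by decide) _) fun _ _ h => h
    · refine Ends.of_exec (by trivial) (by decide) (.inl ⟨?_, ?_⟩)
      · simp only [Program.exec]
        rw [hf₂.1 8 rfl, a8]
      · simpa [Test.Holds, hs₂] using h
    · have h : 1 < keptSum m (s.nat 8) (s.real 3) + movedSum m (s.nat 8) (s.real 4) := by
        simpa [Test.Holds, hs₂] using h
      refine (Ends.for (fun i s₃ => ∀ o < i, s₃.nat 8 o = 0) (by decide) rfl rfl hm₂ ?_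
        (by simp) fun i s₃ hi hi' hf₃ hI => ?_).imp le_rfl fun _ _ h' => .inr ⟨h', h⟩
      · intro i s' v h
        simpa using h
      · refine Ends.of_exec (by trivial) (by decide) fun o ho => ?_
        rcases Nat.lt_succ_iff_lt_or_eq.1 ho with h | rfl
        · simpa [Program.exec, NExpr.eval, hi', h.ne] using hI o h
        · simp [Program.exec, NExpr.eval, hi']

/-- Give preferred items back to the first agent as long as the second agent is envious. -/
def repairProgram : Program :=
  .seq (.setReal 9 (.const 0) (.ofNat (.const 0)))
    (.seq (.for 3 0 (.ite (.natEq (.at 8 3) (.const 1)) .skip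
        (.setReal 9 (.const 0) (.add (.var 9) (.at 4 3)))))
      (.for 3 0 (.ite (.and (.and (.natEq (.at 6 3) (.const 1))
          (.not (.natEq (.at 8 3) (.const 1))))
          (.not (.realLe (.sub (.add (.var 9) (.var 9)) (.at 4 3)) .one)))
        (.seq (.setNat 8 (.var 3) (.const 1))
          (.setReal 9 (.const 0) (.sub (.var 9) (.at 4 3))))
        .skip)))

/-- One pass suffices: an item that passes the test stays harmless, because later transfers only
lower what `q` holds. -/
theorem repairProgram_spec {s : State} {m : ℕ} {c : ℝ} {f : ℕ → ℕ} {α β u : ℕ → ℝ}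
    (hm : s.nat 0 0 = m) (hf : s.nat 6 = f) (hβ : s.real 4 = β)
    (hu : ∀ o < m, u o = if f o = 1 then α o else 0) (hle : ∀ o < m, f o = 1 → α o ≤ β o)
    (hβ0 : ∀ o < m, 0 ≤ β o)
    (hK : KeptEF1 m u (s.nat 8)) (hKf : ∀ o < m, s.nat 8 o = 1 → f o = 1)
    (hc : keptSum m (s.nat 8) α + movedSum m (s.nat 8) β ≤ c) (hc1 : c ≤ 1) :
    Ends repairProgram s ((m + 1) * 200) fun s' =>
      KeptEF1 m u (s'.nat 8) ∧ (∀ o < m, s'.nat 8 o = 1 → f o = 1) ∧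
      keptSum m (s'.nat 8) α + movedSum m (s'.nat 8) β ≤ c ∧
      ∀ o < m, f o = 1 → s'.nat 8 o ≠ 1 → 2 * movedSum m (s'.nat 8) β - β o ≤ 1 := by
  refine (Ends.seq (n₁ := 10) (p := fun s₁ => s₁.real 9 0 = 0)
    (Ends.of_exec (by trivial) (by decide) (by simp [Program.exec, RExpr.eval, NExpr.eval]))
    fun s₁ hf₁ hs₁ => ?_).imp (n := 10 + ((m + 1) * (50 + 14) +
      (m + 1) * (80 + 14))) (by omega) fun _ _ h => h
  have hm₁ : s₁.nat 0 0 = m := by rw [hf₁.1 0 rfl, hm]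
  have a8 : s₁.nat 8 = s.nat 8 := hf₁.1 8 rfl
  have a6 : s₁.nat 6 = f := by rw [hf₁.1 6 rfl, hf]
  have a4 : s₁.real 4 = β := by rw [hf₁.2 4 rfl, hβ]
  refine (Ends.for (fun i s₂ => s₂.real 9 0 = movedSum i (s.nat 8) β)
    (by decide) rfl rfl hm₁ (fun i s' v h => h) (by simp [hs₁, movedSum])
    fun i s₂ hi hi' hf₂ hI => ?_).seq fun s₂ hf₂ hs₂ => ?_
  · have b8 : s₂.nat 8 = s.nat 8 := by rw [hf₂.1 8 rfl, a8]
    have b4 : s₂.real 4 = β := by rw [hf₂.2 4 rfl, a4]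
    refine Ends.of_exec (by simp [Program.LoopFree]) (by decide) ?_
    rw [movedSum_succ]
    by_cases h : s.nat 8 i = 1 <;>
      simp [Program.exec, RExpr.eval, NExpr.eval, hi', b8, b4, h, hI]
  have hm₂ : s₂.nat 0 0 = m := by rw [hf₂.1 0 rfl, hm₁]
  have b8 : s₂.nat 8 = s.nat 8 := by rw [hf₂.1 8 rfl, a8]
  refine (Ends.for (fun i s₃ => s₃.real 9 0 = movedSum m (s₃.nat 8) β ∧
      KeptEF1 m u (s₃.nat 8) ∧ (∀ o < m, s₃.nat 8 o = 1 → f o = 1) ∧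
      keptSum m (s₃.nat 8) α + movedSum m (s₃.nat 8) β ≤ c ∧
      ∀ o < i, f o = 1 → s₃.nat 8 o ≠ 1 → 2 * movedSum m (s₃.nat 8) β - β o ≤ 1)
    (by decide) rfl rfl hm₂ ?_ ?_ fun i s₃ hi hi' hf₃ hI => ?_).imp le_rfl fun _ _ h => h.2
  · intro i s' v h
    have : (s'.putNat 3 0 v).nat 8 = s'.nat 8 := by ext; simp
    rw [this]
    exact h
  · rw [b8]
    exact ⟨hs₂, hK, hKf, hc, by simp⟩
  · obtain ⟨hy, hE, hsub, hcost, hdone⟩ := hI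
    have c6 : s₃.nat 6 = f := by rw [hf₃.1 6 rfl, hf₂.1 6 rfl, a6]
    have c4 : s₃.real 4 = β := by rw [hf₃.2 4 rfl, hf₂.2 4 rfl, a4]
    refine Ends.of_exec (by simp [Program.LoopFree]) (by decide) ?_
    set K := s₃.nat 8 with hKdef
    by_cases h : (f i = 1 ∧ K i ≠ 1) ∧ 1 < 2 * movedSum m K β - β i
    · have hexec : Program.exec (.ite (.and (.and (.natEq (.at 6 3) (.const 1))
            (.not (.natEq (.at 8 3) (.const 1))))
            (.not (.realLe (.sub (.add (.var 9) (.var 9)) (.at 4 3)) .one)))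
          (.seq (.setNat 8 (.var 3) (.const 1))
            (.setReal 9 (.const 0) (.sub (.var 9) (.at 4 3)))) .skip) s₃ =
          (s₃.putNat 8 i 1).putReal 9 0 (movedSum m K β - β i) := by
        rw [Program.exec, if_pos]
        · simp [Program.exec, RExpr.eval, NExpr.eval, hi', hy, c4]
        · simpa [Test.Holds, RExpr.eval, NExpr.eval, hi', hy, c4, c6, ← two_mul, ← hKdef,
            lt_sub_iff_add_lt]
            using h
      rw [hexec]
      have hK' : ((s₃.putNat 8 i 1).putReal 9 0 (movedSum m K β - β i)).nat 8 =
          Function.update K i 1 := by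
        rw [State.putReal_nat, State.putNat_nat_self]
      rw [hK']
      obtain ⟨⟨hfi, hKi⟩, hlt⟩ := h
      have e1 := keptSum_update hi hKi α
      have e2 := movedSum_update hi hKi β
      refine ⟨?_, ChoreInstance.keptEF1_update hi hfi hu (hle i hi hfi) hsub hKi
        (hcost.trans hc1) hlt, fun o ho ho1 => ?_, ?_, fun o ho hfo hKo => ?_⟩
      · simp
        linarith
      · by_cases hoi : o = i
        · rw [hoi]; exact hfi
        · rw [Function.update_of_ne hoi] at ho1
          exact hsub o ho ho1
      · linarith [hle i hi hfi]
      · have hoi : o ≠ i := by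
          rintro rfl
          simp at hKo
        rw [Function.update_of_ne hoi] at hKo
        linarith [hdone o (by omega) hfo hKo, hβ0 i hi]
    · have hexec : Program.exec (.ite (.and (.and (.natEq (.at 6 3) (.const 1))
            (.not (.natEq (.at 8 3) (.const 1))))
            (.not (.realLe (.sub (.add (.var 9) (.var 9)) (.at 4 3)) .one)))
          (.seq (.setNat 8 (.var 3) (.const 1))
            (.setReal 9 (.const 0) (.sub (.var 9) (.at 4 3)))) .skip) s₃ = s₃ := by
        rw [Program.exec, if_neg]
        · rfl
        · intro h'
          refine h ?_
          simpa [Test.Holds, RExpr.eval, NExpr.eval, hi', hy, c4, c6, ← two_mul, ← hKdef,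
            lt_sub_iff_add_lt]
            using h'
      rw [hexec]
      refine ⟨hy, hE, hsub, hcost, fun o ho hfo hKo => ?_⟩
      rcases Nat.lt_succ_iff_lt_or_eq.1 ho with h' | rfl
      · exact hdone o h' hfo hKo
      · by_contra! hlt
        exact h ⟨⟨hfo, hKo⟩, hlt⟩

/-! ### Output and choice of the order of the agents -/

/-- Write the allocation. -/
def outputProgram : Program :=
  .for 3 0 (.ite (.natEq (.at 8 3) (.const 1)) (.setNat 1 (.var 3) (.var 12))
    (.setNat 1 (.var 3) (.sub (.const 1) (.var 12))))

theorem outputProgram_spec {s : State} {m : ℕ} {p q : Fin 2} (hpq : p ≠ q)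
    (hm : s.nat 0 0 = m) (hp : s.nat 12 0 = p) :
    Ends outputProgram s ((m + 1) * 100) fun s' =>
      Outputs s' (ChoreInstance.allocationOf m p q (s.nat 8)) := by
  have hq : (q : ℕ) = 1 - p := by omega
  refine (Ends.for (k := 86)
    (fun i s' => ∀ o < i, s'.nat 1 o = if s.nat 8 o = 1 then (p : ℕ) else q)
    (by decide) rfl rfl hm (fun i s' v h => ?_) (by simp) fun i s' hi hi' hf hI => ?_).imp
    le_rfl fun s' _ h o => ?_
  · simpa using h
  · have a8 : s'.nat 8 = s.nat 8 := hf.1 8 rfl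
    have a12 : s'.nat 12 0 = p := by rw [hf.1 12 rfl, hp]
    refine Ends.of_exec (by simp [Program.LoopFree]) (by decide) fun o ho => ?_
    rcases Nat.lt_succ_iff_lt_or_eq.1 ho with h | rfl
    · have := hI o h
      by_cases h8 : s.nat 8 i = 1 <;>
        simpa [Program.exec, NExpr.eval, hi', a8, h8, h.ne] using this
    · by_cases h8 : s.nat 8 o = 1 <;>
        simp [Program.exec, NExpr.eval, hi', a8, h8, a12, hq]
  · rw [h o o.2, ChoreInstance.allocationOf]
    split_ifs <;> rfl

/-- Choose the order of the agents, so that the items which are not cheaper for the first agent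
cost at most `1 / 2` for the second agent. -/
def agentProgram : Program :=
  .seq balanceProgram
    (.ite (.realLe (.add (.var 6) (.var 6)) .one)
      (.seq (.setNat 12 (.const 0) (.const 1)) (orientProgram 2 1 (.realLe (.at 2 3) (.at 1 3))))
      (.seq (.setNat 12 (.const 0) (.const 0))
        (orientProgram 1 2 (.not (.realLe (.at 2 3) (.at 1 3))))))

/-- Let `x` be the cost for agent `0` of the items strictly cheaper for this agent. If `x ≤ 1 / 2`,
agent `0` is `q` and these are the unflagged items. Otherwise agent `1` is `q`; the unflagged items
then cost agent `1` no more than agent `0`, that is, at most `1 - x`. -/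
theorem agentProgram_spec {m : ℕ} (I : ChoreInstance 2 m) {s : State}
    (hm : s.nat 0 0 = m) (h6 : s.real 6 0 = 0) (h1 : s.real 1 = I.itemCost 0)
    (h2 : s.real 2 = I.itemCost 1) :
    Ends agentProgram s ((m + 1) * 600) fun s' => ∃ p q : Fin 2, p ≠ q ∧ s'.nat 12 0 = p ∧
      movedSum m (s'.nat 6) (I.itemCost q) ≤ 1 / 2 ∧ ∀ o < m,
        s'.real 3 o = I.itemCost p o ∧ s'.real 4 o = I.itemCost q o ∧
        (s'.nat 6 o = 1 → I.itemCost p o ≤ I.itemCost q o) ∧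
        (s'.nat 6 o ≠ 1 → I.itemCost q o ≤ I.itemCost p o) ∧
        (s'.real 7 o = if s'.nat 6 o = 1 then I.itemCost p o else 0) ∧
        (s'.real 8 o = if s'.nat 6 o = 1 then I.itemCost q o - I.itemCost p o else 0) := by
  refine ((balanceProgram_spec hm h6).seq (n₂ := 20 + ((10 + (m + 1) * 200) +
    (10 + (m + 1) * 200))) fun s₁ hf₁ hs₁ => ?_).imp (by omega) fun _ _ h => h
  have hm₁ : s₁.nat 0 0 = m := by rw [hf₁.1 0 rfl, hm]
  have a1 : s₁.real 1 = I.itemCost 0 := by rw [hf₁.2 1 rfl, h1]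
  have a2 : s₁.real 2 = I.itemCost 1 := by rw [hf₁.2 2 rfl, h2]
  rw [h1, h2] at hs₁
  set x := s₁.real 6 0 with hx
  refine (Ends.ite (n₁ := 10 + (m + 1) * 200) (n₂ := 10 + (m + 1) * 200)
    (fun h => ?_) fun h => ?_).imp (Nat.add_le_add_right (by decide) _) fun _ _ h => h
  · have h : x + x ≤ 1 := by simpa [Test.Holds, RExpr.eval, ← hx] using h
    refine Ends.seq (p := fun s₂ => s₂.nat 12 0 = 1) (Ends.of_exec (by trivial) (by decide)
      (by simp [Program.exec, NExpr.eval])) fun s₂ hf₂ hs₂ => ?_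
    have b1 : s₂.real 1 = I.itemCost 0 := by rw [hf₂.2 1 rfl, a1]
    have b2 : s₂.real 2 = I.itemCost 1 := by rw [hf₂.2 2 rfl, a2]
    refine (orientProgram_spec (fun o => I.itemCost 1 o ≤ I.itemCost 0 o) (.inr rfl) (.inl rfl)
      (by decide) (by rw [hf₂.1 0 rfl, hm₁]) fun s' e1 e2 => ?_).imp le_rfl
      fun s₃ hf₃ hs₃ => ⟨1, 0, by decide, by rw [hf₃.1 12 rfl, hs₂]; rfl, ?_, fun o ho => ?_⟩
    · simp [Test.Holds, e1, e2, b1, b2]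
    · have : movedSum m (s₃.nat 6) (I.itemCost 0) = x := by
        rw [hs₁]
        refine Finset.sum_congr rfl fun o ho => ?_
        rw [(hs₃ o (Finset.mem_range.1 ho)).2.2.1]
        by_cases hle : I.itemCost 1 o ≤ I.itemCost 0 o <;> simp [hle]
      linarith
    · obtain ⟨e3, e4, e6, e7, e8⟩ := hs₃ o ho
      rw [b2] at e3
      rw [b1] at e4
      by_cases hle : I.itemCost 1 o ≤ I.itemCost 0 o
      · simp [e3, e4, e6, e7, e8, hle, b1, b2]
      · simp [e3, e4, e6, e7, e8, hle, (not_le.1 hle).le]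
  · have h : 1 < x + x := by simpa [Test.Holds, RExpr.eval, ← hx] using h
    refine Ends.seq (p := fun s₂ => s₂.nat 12 0 = 0) (Ends.of_exec (by trivial) (by decide)
      (by simp [Program.exec, NExpr.eval])) fun s₂ hf₂ hs₂ => ?_
    have b1 : s₂.real 1 = I.itemCost 0 := by rw [hf₂.2 1 rfl, a1]
    have b2 : s₂.real 2 = I.itemCost 1 := by rw [hf₂.2 2 rfl, a2]
    refine (orientProgram_spec (fun o => ¬ I.itemCost 1 o ≤ I.itemCost 0 o) (.inl rfl)
      (.inr rfl) (by decide) (by rw [hf₂.1 0 rfl, hm₁]) fun s' e1 e2 => ?_).imp le_rfl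
      fun s₃ hf₃ hs₃ => ⟨0, 1, by decide, by rw [hf₃.1 12 rfl, hs₂]; rfl, ?_, fun o ho => ?_⟩
    · simp [Test.Holds, e1, e2, b1, b2]
    · have : movedSum m (s₃.nat 6) (I.itemCost 1) + x ≤ 1 := by
        rw [hs₁, ← I.sum_itemCost 0, movedSum, ← Finset.sum_add_distrib]
        refine Finset.sum_le_sum fun o ho => ?_
        rw [(hs₃ o (Finset.mem_range.1 ho)).2.2.1]
        by_cases hle : I.itemCost 1 o ≤ I.itemCost 0 o <;> simp [hle]
      linarith
    · obtain ⟨e3, e4, e6, e7, e8⟩ := hs₃ o ho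
      rw [b1] at e3
      rw [b2] at e4
      by_cases hle : I.itemCost 1 o ≤ I.itemCost 0 o
      · simp [e3, e4, e6, e7, e8, hle]
      · simp [e3, e4, e6, e7, e8, hle, (not_le.1 hle).le, b1, b2]

/-! ### Assembly of the algorithm -/

/-- The algorithm. -/
def choreProgram : Program :=
  .seq gridProgram (.seq agentProgram (.seq roundProgram
    (.seq (.setNat 9 (.const 0) (.var 2)) (.seq guessProgram
      (.seq limitProgram (.seq repairProgram outputProgram))))))

theorem choreProgram_spec {m : ℕ} (I : ChoreInstance 2 m) {ε : ℝ} (hε : 0 < ε) :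
    Ends choreProgram (input I ε) ((m + 1) ^ 2 * (⌈m / ε⌉₊ + 2) * 5000) fun s =>
      ∃ A : Allocation 2 m, Outputs s A ∧ I.IsEF1 A ∧ I.socialCost A ≤ I.optEF1 + ε := by
  -- Without items the costs could not add up to `1`.
  have hm : 0 < m := by
    rcases Nat.eq_zero_or_pos m with rfl | h
    · simpa using I.cost_total 0
    · exact h
  set N := ⌈m / ε⌉₊ with hN
  have hNε : (m : ℝ) ≤ N * ε := by
    have := Nat.le_ceil ((m : ℝ) / ε)
    rwa [div_le_iff₀ hε] at this
  have i0 : (input I ε).nat 0 0 = m := by simp [input]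
  have i1 : (input I ε).real 1 = I.itemCost 0 := by
    ext o; simp [input, ChoreInstance.itemCost]
  have i2 : (input I ε).real 2 = I.itemCost 1 := by
    ext o; simp [input, ChoreInstance.itemCost]
  refine ((gridProgram_spec (ε := ε) i0 (by simp [input]) (by simp [input]) hε).seq
    (n₂ := (m + 1) * 600 + ((m + 1) * ((N + 1) * 100 + 30) + (10 +
      ((m + 1) * ((m + 1) * ((N + 2) * 600)) + ((m + 1) * 200 + ((m + 1) * 200 +
      (m + 1) * 100)))))) fun s₁ f₁ hs₁ => ?_).imp ?_ fun _ _ h => h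
  swap
  · rw [← hN]
    have : 1 ≤ m + 1 := by omega
    generalize m + 1 = X at *
    have h1 : X ≤ X ^ 2 := Nat.le_self_pow two_ne_zero X
    have h2 : X * (N + 2) ≤ X ^ 2 * (N + 2) := Nat.mul_le_mul_right _ h1
    have h3 : 1 * (N + 2) ≤ X * (N + 2) := Nat.mul_le_mul_right _ this
    have h4 : X * 2 ≤ X * (N + 2) := Nat.mul_le_mul_left _ (by omega)
    nlinarith
  rw [← hN] at hs₁
  have a0 : s₁.nat 0 0 = m := by rw [f₁.1 0 rfl, i0]
  refine (agentProgram_spec I a0 (by rw [f₁.2 6 rfl]; simp [input]) (by rw [f₁.2 1 rfl, i1])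
    (by rw [f₁.2 2 rfl, i2])).seq fun s₂ f₂ hs₂ => ?_
  obtain ⟨p, q, hpq, hp, hhalf, hs₂⟩ := hs₂
  have b0 : s₂.nat 0 0 = m := by rw [f₂.1 0 rfl, a0]
  have hf : ∃ f, s₂.nat 6 = f := ⟨_, rfl⟩
  obtain ⟨f, hf⟩ := hf
  rw [hf] at hhalf hs₂
  have hα0 := I.itemCost_nonneg p
  have hβ0 := I.itemCost_nonneg q
  have hδ0 : ∀ o < m, 0 ≤ s₂.real 8 o := fun o ho => by
    obtain ⟨-, -, h1, -, -, h8⟩ := hs₂ o ho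
    rw [h8]
    split_ifs with h
    · linarith [h1 h]
    · exact le_rfl
  have hδ1 : ∑ o ∈ Finset.range m, s₂.real 8 o ≤ 1 := by
    rw [← I.sum_itemCost q]
    refine Finset.sum_le_sum fun o ho => ?_
    obtain ⟨-, -, -, -, -, h8⟩ := hs₂ o (Finset.mem_range.1 ho)
    rw [h8]
    split_ifs
    · linarith [hα0 o]
    · exact hβ0 o
  refine (roundProgram_spec (ε := ε) b0 (by rw [f₂.1 2 rfl, hs₁.1])
    (by rw [f₂.2 0 rfl, f₁.2 0 rfl]; simp [input]) hε hδ0 fun o ho => ?_).seq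
    fun s₃ f₃ hs₃ => ?_
  · have h1 : s₂.real 8 o ≤ 1 :=
      (Finset.single_le_sum (fun o ho => hδ0 o (Finset.mem_range.1 ho))
        (Finset.mem_range.2 ho)).trans hδ1
    have : s₂.real 8 o * m ≤ 1 * m := mul_le_mul_of_nonneg_right h1 (Nat.cast_nonneg m)
    linarith
  refine Ends.seq (p := fun s₄ => s₄.nat 9 0 = N) (Ends.of_exec (by trivial) (by decide) ?_)
    fun s₄ f₄ hs₄ => ?_
  · have : s₃.nat 2 0 = N := by rw [f₃.1 2 rfl, f₂.1 2 rfl, hs₁.1]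
    simp [Program.exec, NExpr.eval, this]
  have d7 : s₄.nat 7 = s₃.nat 7 := f₄.1 7 rfl
  have u7 : s₄.real 7 = s₂.real 7 := by rw [f₄.2 7 rfl, f₃.2 7 rfl]
  have hzero : ∀ o < m, f o ≠ 1 → s₄.nat 7 o = 0 ∧ s₄.real 7 o = 0 := fun o ho hfo => by
    obtain ⟨-, -, -, -, h7, h8⟩ := hs₂ o ho
    rw [d7, u7, h7, if_neg hfo]
    refine ⟨?_, rfl⟩
    have := (hs₃ o ho).1
    rw [h8, if_neg hfo, zero_mul] at this
    have h' : (s₃.nat 7 o : ℝ) ≤ 0 := nonpos_of_mul_nonpos_left this hε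
    exact_mod_cast le_antisymm h' (Nat.cast_nonneg _)
  have hd : ∑ o ∈ Finset.range m, s₄.nat 7 o ≤ N := by
    have h1 : ((∑ o ∈ Finset.range m, s₄.nat 7 o : ℕ) : ℝ) * ε ≤ N * ε := by
      rw [d7, Nat.cast_sum, Finset.sum_mul]
      calc _ ≤ ∑ o ∈ Finset.range m, s₂.real 8 o * m :=
            Finset.sum_le_sum fun o ho => (hs₃ o (Finset.mem_range.1 ho)).1
        _ = (∑ o ∈ Finset.range m, s₂.real 8 o) * m := by rw [Finset.sum_mul]
        _ ≤ 1 * m := mul_le_mul_of_nonneg_right hδ1 (Nat.cast_nonneg m)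
        _ ≤ N * ε := by linarith
    exact_mod_cast le_of_mul_le_mul_right h1 hε
  have c0 : s₄.nat 0 0 = m := by rw [f₄.1 0 rfl, f₃.1 0 rfl, b0]
  refine (guessProgram_spec (f := f) c0
    (by rw [f₄.1 2 rfl, f₃.1 2 rfl, f₂.1 2 rfl, hs₁.1])
    (by rw [f₄.1 13 rfl, f₃.1 13 rfl, f₂.1 13 rfl, hs₁.2]) hs₄
    (by rw [f₄.1 8 rfl, f₃.1 8 rfl, f₂.1 8 rfl, f₁.1 8 rfl]; ext; simp [input]) hd hzero).seq
    fun s₅ f₅ hs₅ => ?_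
  obtain ⟨best, hE, hmv, hKf, hopt⟩ := hs₅
  rw [u7] at hE hopt
  rw [d7] at hmv hopt
  have e0 : s₅.nat 0 0 = m := by rw [f₅.1 0 rfl, c0]
  have e3 : s₅.real 3 = s₂.real 3 := by rw [f₅.2 3 rfl, f₄.2 3 rfl, f₃.2 3 rfl]
  have e4 : s₅.real 4 = s₂.real 4 := by rw [f₅.2 4 rfl, f₄.2 4 rfl, f₃.2 4 rfl]
  have e6 : s₅.nat 6 = f := by rw [f₅.1 6 rfl, f₄.1 6 rfl, f₃.1 6 rfl, hf]
  have e12 : s₅.nat 12 0 = p := by rw [f₅.1 12 rfl, f₄.1 12 rfl, f₃.1 12 rfl, hp]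
  have hu : ∀ o < m, s₂.real 7 o = if f o = 1 then I.itemCost p o else 0 :=
    fun o ho => (hs₂ o ho).2.2.2.2.1
  have k3 : ∀ K, keptSum m K (s₂.real 3) = keptSum m K (I.itemCost p) := fun K =>
    Finset.sum_congr rfl fun o ho => by rw [(hs₂ o (Finset.mem_range.1 ho)).1]
  have k4 : ∀ K, movedSum m K (s₂.real 4) = movedSum m K (I.itemCost q) := fun K =>
    Finset.sum_congr rfl fun o ho => by rw [(hs₂ o (Finset.mem_range.1 ho)).2.1]
  -- Stated for every EF1 allocation `B`, since at this point none is known to exist.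
  have hnear : ∀ B : Allocation 2 m, I.IsEF1 B →
      keptSum m (s₅.nat 8) (I.itemCost p) + movedSum m (s₅.nat 8) (I.itemCost q) ≤
        I.socialCost B + ε := by
    intro B hB
    obtain ⟨g, hg, hgB⟩ := I.keptEF1_preferredBits hpq hu hB hm
    have h1 := I.cost_preferredBits_le hpq (fun o ho => (hs₂ o ho).2.2.2.1) B
    have h2 := ChoreInstance.cost_le_of_rounded_le (α := I.itemCost p) (β := I.itemCost q)
      (δ := s₂.real 8) (K' := ChoreInstance.preferredBits B p f) hm hε.le
      (fun o ho => (hs₂ o ho).2.2.2.2.2) hs₃ hKf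
      (fun o ho h => ((ChoreInstance.preferredBits_eq_one ho).1 h).2) hmv (hopt g hg _ hgB)
    linarith
  refine (limitProgram_spec e0).seq fun s₆ f₆ hs₆ => ?_
  rw [e3, e4, k3, k4] at hs₆
  set cost := fun K : ℕ → ℕ => keptSum m K (I.itemCost p) + movedSum m K (I.itemCost q)
    with hcost
  have hlim : KeptEF1 m (s₂.real 7) (s₆.nat 8) ∧ (∀ o < m, s₆.nat 8 o = 1 → f o = 1) ∧
      cost (s₆.nat 8) ≤ 1 ∧ cost (s₆.nat 8) ≤ cost (s₅.nat 8) := by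
    rcases hs₆ with ⟨h, h1⟩ | ⟨h, h1⟩
    · rw [h]
      exact ⟨hE, hKf, h1, le_rfl⟩
    · have z1 : ∀ w : ℕ → ℝ, keptSum m (s₆.nat 8) w = 0 := fun w =>
        Finset.sum_eq_zero fun o ho => by simp [h o (Finset.mem_range.1 ho)]
      have z2 : movedSum m (s₆.nat 8) (I.itemCost q) = 1 := by
        rw [← I.sum_itemCost q, ← keptSum_add_movedSum m (s₆.nat 8), z1, zero_add]
      have z3 : cost (s₆.nat 8) = 1 := by simp [hcost, z1, z2]
      refine ⟨⟨0, by simp [z1]⟩, fun o ho h' => by simp [h o ho] at h', z3.le, ?_⟩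
      rw [z3]
      exact h1.le
  obtain ⟨hE₆, hKf₆, hc₆, hc₆'⟩ := hlim
  refine (repairProgram_spec (f := f) (α := I.itemCost p) (β := s₂.real 4)
    (c := cost (s₆.nat 8)) (by rw [f₆.1 0 rfl, e0]) (by rw [f₆.1 6 rfl, e6])
    (by rw [f₆.2 4 rfl, e4]) hu
    (fun o ho h => by rw [(hs₂ o ho).2.1]; exact (hs₂ o ho).2.2.1 h)
    (fun o ho => by rw [(hs₂ o ho).2.1]; exact hβ0 o) hE₆ hKf₆
    (by rw [k4]) hc₆).seq fun s₇ f₇ hs₇ => ?_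
  obtain ⟨hE₇, hKf₇, hc₇, hdone⟩ := hs₇
  rw [k4] at hc₇ hdone
  have hEF1 : I.IsEF1 (ChoreInstance.allocationOf m p q (s₇.nat 8)) :=
    I.isEF1_allocationOf hpq hu hhalf hKf₇ hE₇ fun o ho hfo hK => by
      have := hdone o ho hfo hK
      rwa [(hs₂ o ho).2.1] at this
  refine (outputProgram_spec hpq (by rw [f₇.1 0 rfl, f₆.1 0 rfl, e0])
    (by rw [f₇.1 12 rfl, f₆.1 12 rfl, e12])).imp le_rfl fun s₈ _ hs₈ => ⟨_, hs₈, ?_, ?_⟩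
  · exact hEF1
  -- The output itself shows that EF1 allocations exist, so the infimum is attained by some `B`.
  · obtain ⟨⟨B, hB, hBcost⟩, -⟩ := I.isLeast_optEF1 ⟨_, _, hEF1, rfl⟩
    rw [I.socialCost_allocationOf, ← hBcost]
    have := hnear B hB
    linarith

end RealRAM

/-- There is an algorithm (one real RAM program for all instances and all accuracies) that
computes, for two agents with `m` chores and for every `ε > 0`, an EF1 allocation of social cost
at most `OPT^EF1 + ε`, in a number of steps that is polynomial in `m` and `1 / ε`. -/
theorem theorem11 :
    ∃ (P : RealRAM.Program) (p : MvPolynomial (Fin 2) ℝ),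
      ∀ (m : ℕ) (I : ChoreInstance 2 m) (ε : ℝ), 0 < ε →
        ∃ (t : ℕ) (s : RealRAM.State) (A : Allocation 2 m),
          RealRAM.Runs P (RealRAM.input I ε) t s ∧
          (t : ℝ) ≤ MvPolynomial.eval ![(m : ℝ), 1 / ε] p ∧
          RealRAM.Outputs s A ∧
          I.IsEF1 A ∧
          I.socialCost A ≤ I.optEF1 + ε := by
  -- The constant `3` is the `2` of the step bound plus `1` for the ceiling of `m / ε`.
  refine ⟨RealRAM.choreProgram, (MvPolynomial.X 0 + 1) ^ 2 *
    (MvPolynomial.X 0 * MvPolynomial.X 1 + 3) * MvPolynomial.C 5000, fun m I ε hε => ?_⟩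
  obtain ⟨t, s, hrun, ht, A, hout, hEF1, hcost⟩ := RealRAM.choreProgram_spec I hε
  refine ⟨t, s, A, hrun, ?_, hout, hEF1, hcost⟩
  have h1 : (t : ℝ) ≤ (m + 1) ^ 2 * ((⌈m / ε⌉₊ : ℝ) + 2) * 5000 := by exact_mod_cast ht
  have h2 : (⌈m / ε⌉₊ : ℝ) < m / ε + 1 := Nat.ceil_lt_add_one (by positivity)
  have h3 : ((m : ℝ) + 1) ^ 2 * ((⌈m / ε⌉₊ : ℝ) + 2) * 5000 ≤
      (m + 1) ^ 2 * (m * (1 / ε) + 3) * 5000 := by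
    have : (m : ℝ) * (1 / ε) = m / ε := by ring
    rw [this]
    have h4 : (⌈m / ε⌉₊ : ℝ) + 2 ≤ m / ε + 3 := by linarith
    gcongr
  simpa using h1.trans h3
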